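/- Let $\Omega\subseteq\mathbb{C}$ be a domain and let $p\in\mathbb{C}\setminus\Omega$ be such that $\Omega$ contains a punctured neighbourhood of $p$. Let $\lambda(z)|dz|$ be a regular conformal metric on $\Omega$ (with an isolated singularity at $p$), i.e. $\lambda:\Omega\to(0,\infty)$ is twice continuously differentiable. Suppose that its Gaussian curvature $\kappa(z)=-\Delta\log\lambda(z)/\lambda(z)^2$, $z\in\Omega$, extends to a locally Hölder continuous function $\kappa:\Omega\cup\{p\}\to\mathbb{R}$ (with some exponent $\nu\in(0,1]$) such that $\kappa(p)<0$, and that $\log\lambda$ has order $1$ at $p$, that is, $$\lim_{r\to0^+}\frac{\sup_{|z-p|=r}\log\lambda(z)}{\log(1/r)}=1 .$$ Write $\lambda_z=\tfrac12(\lambda_x-i\lambda_y)$, $\lambda_{zz}=(\lambda_z)_z$ and $\lambda_{z\bar z}=(\lambda_z)_{\bar z}$, where $f_{\bar z}=\tfrac12(f_x+if_y)$. Then (i) $\displaystyle\lim_{z\to p}(z-p)\,|z-p|\,\log\frac1{|z-p|}\;\lambda_z(z)=-\frac1{2\sqrt{-\kappa(p)}}$; (ii) $\displaystyle\lim_{z\to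 p}(z-p)^2\,|z-p|\,\log\frac1{|z-p|}\;\lambda_{zz}(z)=\frac3{4\sqrt{-\kappa(p)}}$; (iii) $\displaystyle\lim_{z\to p}|z-p|^3\,\log\frac1{|z-p|}\;\lambda_{z\bar z}(z)=\frac1{4\sqrt{-\kappa(p)}}$. -/

import Mathlib

open Filter Topology
open scoped NNReal

noncomputable section

namespace ConformalMetric

/-- The Wirtinger derivative `∂f/∂z = (1/2) (∂f/∂x - i ∂f/∂y)` of `f : ℂ → ℂ`
(only real differentiability of `f` is relevant). -/
def dz (f : ℂ → ℂ) (z : ℂ) : ℂ :=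
  (1 / 2 : ℂ) * (fderiv ℝ f z 1 - Complex.I * fderiv ℝ f z Complex.I)

/-- The Wirtinger derivative `∂f/∂z̄ = (1/2) (∂f/∂x + i ∂f/∂y)` of `f : ℂ → ℂ`
(only real differentiability of `f` is relevant). -/
def dzbar (f : ℂ → ℂ) (z : ℂ) : ℂ :=
  (1 / 2 : ℂ) * (fderiv ℝ f z 1 + Complex.I * fderiv ℝ f z Complex.I)

/-- `lam(z)|dz|` is a regular conformal metric on `Ω`: its density is positive and twice
continuously differentiable (in the real sense) on `Ω`. -/
structure IsRegular (lam : ℂ → ℝ) (Ω : Set ℂ) : Prop where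
  pos : ∀ z ∈ Ω, 0 < lam z
  contDiffOn : ContDiffOn ℝ 2 lam Ω

/-- The Gaussian curvature `- (Δ log lam) / lam ^ 2` of the metric `lam(z)|dz|`. -/
def curvature (lam : ℂ → ℝ) (z : ℂ) : ℝ :=
  -(Laplacian.laplacian (fun w : ℂ => Real.log (lam w)) z) / lam z ^ 2

/-- `f` is locally Hölder continuous on `S` with exponent `ν`. -/
def LocallyHolderOn (ν : ℝ≥0) (f : ℂ → ℝ) (S : Set ℂ) : Prop :=
  ∀ x ∈ S, ∃ C : ℝ≥0, ∃ U ∈ 𝓝 x, HolderOnWith C ν f (U ∩ S)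

/-- The supremum of `u` over the circle `|z - p| = r`. It is only used for `u` continuous in a
punctured neighbourhood of `p` and for small `r > 0`, where it is a maximum. -/
def circleSup (u : ℂ → ℝ) (p : ℂ) (r : ℝ) : ℝ :=
  sSup (u '' Metric.sphere p r)

/-- `u` has order `α` at `p`: the limit as `r → 0+` of
`sup_{|z - p| = r} u(z) / log (1 / r)` exists and equals `α`. -/
def HasOrderAt (u : ℂ → ℝ) (p : ℂ) (α : ℝ) : Prop :=
  Tendsto (fun r : ℝ => circleSup u p r / Real.log (1 / r)) (𝓝[>] 0) (𝓝 α)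

end ConformalMetric

end

/-!
In the coordinate `w` with `z = p + e^w`, a punctured disc about `p` becomes a half-plane far to the
left, and `V(w) = log λ(p + e^w) + re w` is a `2πi`-periodic solution of `ΔV = K e^{2V}` with
`K(w) = -κ(p + e^w) → k₀ = -κ(p) > 0`. The three limits follow from
`e^V |re w| → 1/√k₀`, `∂V → 0`, `∂∂V → 0` and `∂̄∂V = K e^{2V}/4 → 0` by the chain rule
(`dz_density_mul_cexp`, `second_derivatives_density`), because `λ(p + e^w) = e^{V(w) - re w}`.

*Size of `V`.* For `0 < k < k₀`, comparing `V` with `log (1/τ + 1/(ℓ-τ)) - log √k` on a strip of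
width `ℓ` (`τ` being the distance to its right edge) and letting `ℓ → ∞` gives
`√k e^V (|re w| - T) ≤ 1` (`sqrt_mul_exp_mul_le_one`); periodicity makes the maximum on a strip
exist. Hence `V ≤ 0` and `ΔV` is bounded far to the left. The order hypothesis says that on each
vertical line some point has `V ≥ -o(|re w|)`; the Harnack inequality `neg_add_le_exp_mul` spreads
this over the whole line. With that growth control the maximum principle applies to
`-log (B - re w) - log √k - V` for `k > k₀` (`exists_one_le_sqrt_mul_exp_mul`), which gives the
reverse bound.

*Derivatives of `V`.* All interior estimates come from the first order differential equations
satisfied by the Fourier modes `a_n(r) = ∫ g(c + r e^{iθ}) e^{-inθ} dθ`, namely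
`(r^{-n} a_n(g))' = 2 r^{-n} a_{n+1}(∂̄g)` and `(r^n a_n(g))' = 2 r^n a_{n-1}(∂g)`. Mode `0` gives
the mean value estimate, mode `1` the gradient estimate (and from both the Harnack inequality), and mode
`1` of `∂V` the estimate of `∂∂V` by the size of `∂V` and the Hölder modulus of `∂̄∂V`. Since the
oscillation of `V` on discs of fixed radius, `ΔV`, and the Hölder modulus of `ΔV` all tend to zero,
so do the derivatives.
-/

namespace ConformalMetric

open Complex ComplexConjugate InnerProductSpace MeasureTheory Metric

/-! ### Wirtinger calculus -/

lemma dz_of_hasFDerivAt {f : ℂ → ℂ} {L : ℂ →L[ℝ] ℂ} {z : ℂ} (h : HasFDerivAt f L z) :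
    dz f z = (1 / 2 : ℂ) * (L 1 - I * L I) := by
  rw [dz, h.fderiv]

lemma dzbar_of_hasFDerivAt {f : ℂ → ℂ} {L : ℂ →L[ℝ] ℂ} {z : ℂ} (h : HasFDerivAt f L z) :
    dzbar f z = (1 / 2 : ℂ) * (L 1 + I * L I) := by
  rw [dzbar, h.fderiv]

lemma fderiv_apply_eq_dz_dzbar (f : ℂ → ℂ) (z h : ℂ) :
    fderiv ℝ f z h = dz f z * h + dzbar f z * conj h := by
  have key : fderiv ℝ f z h = h.re * fderiv ℝ f z 1 + h.im * fderiv ℝ f z I := by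
    conv_lhs => rw [show h = h.re • (1 : ℂ) + h.im • I by simp [re_add_im]]
    rw [map_add, map_smul, map_smul, real_smul, real_smul]
  rw [key, dz, dzbar]
  conv_rhs => rw [← re_add_im h]
  simp only [map_add, map_mul, conj_ofReal, conj_I]
  linear_combination ((h.im : ℂ) * fderiv ℝ f z I) * I_sq

lemma dz_congr {f g : ℂ → ℂ} {z : ℂ} (h : f =ᶠ[𝓝 z] g) : dz f z = dz g z := by
  rw [dz, dz, h.fderiv_eq]

lemma dzbar_congr {f g : ℂ → ℂ} {z : ℂ} (h : f =ᶠ[𝓝 z] g) : dzbar f z = dzbar g z := by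
  rw [dzbar, dzbar, h.fderiv_eq]

lemma dz_add {f g : ℂ → ℂ} {z : ℂ} (hf : DifferentiableAt ℝ f z) (hg : DifferentiableAt ℝ g z) :
    dz (fun w => f w + g w) z = dz f z + dz g z := by
  rw [dz_of_hasFDerivAt (hf.hasFDerivAt.fun_add hg.hasFDerivAt), dz, dz]
  simp only [add_apply]
  ring

lemma dzbar_add {f g : ℂ → ℂ} {z : ℂ} (hf : DifferentiableAt ℝ f z)
    (hg : DifferentiableAt ℝ g z) :
    dzbar (fun w => f w + g w) z = dzbar f z + dzbar g z := by
  rw [dzbar_of_hasFDerivAt (hf.hasFDerivAt.fun_add hg.hasFDerivAt), dzbar, dzbar]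
  simp only [add_apply]
  ring

lemma dz_sub_const (f : ℂ → ℂ) (c z : ℂ) : dz (fun w => f w - c) z = dz f z := by
  rw [dz, dz, fderiv_sub_const]

lemma dzbar_sub_const (f : ℂ → ℂ) (c z : ℂ) : dzbar (fun w => f w - c) z = dzbar f z := by
  rw [dzbar, dzbar, fderiv_sub_const]

lemma dz_mul {f g : ℂ → ℂ} {z : ℂ} (hf : DifferentiableAt ℝ f z) (hg : DifferentiableAt ℝ g z) :
    dz (fun w => f w * g w) z = dz f z * g z + f z * dz g z := by
  rw [dz_of_hasFDerivAt (hf.hasFDerivAt.fun_mul hg.hasFDerivAt), dz, dz]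
  simp only [add_apply, smul_apply, smul_eq_mul]
  ring

lemma dzbar_mul {f g : ℂ → ℂ} {z : ℂ} (hf : DifferentiableAt ℝ f z)
    (hg : DifferentiableAt ℝ g z) :
    dzbar (fun w => f w * g w) z = dzbar f z * g z + f z * dzbar g z := by
  rw [dzbar_of_hasFDerivAt (hf.hasFDerivAt.fun_mul hg.hasFDerivAt), dzbar, dzbar]
  simp only [add_apply, smul_apply, smul_eq_mul]
  ring

lemma dz_of_hasDerivAt {f : ℂ → ℂ} {f' z : ℂ} (h : HasDerivAt f f' z) : dz f z = f' := by
  rw [dz_of_hasFDerivAt (h.hasFDerivAt.restrictScalars ℝ)]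
  simp only [ContinuousLinearMap.coe_restrictScalars', ContinuousLinearMap.toSpanSingleton_apply,
    smul_eq_mul]
  linear_combination (-f' / 2) * I_sq

lemma dzbar_of_hasDerivAt {f : ℂ → ℂ} {f' z : ℂ} (h : HasDerivAt f f' z) : dzbar f z = 0 := by
  rw [dzbar_of_hasFDerivAt (h.hasFDerivAt.restrictScalars ℝ)]
  simp only [ContinuousLinearMap.coe_restrictScalars', ContinuousLinearMap.toSpanSingleton_apply,
    smul_eq_mul]
  linear_combination (f' / 2) * I_sq

lemma dz_comp_holomorphic {f ψ : ℂ → ℂ} {ψ' w : ℂ} (hf : DifferentiableAt ℝ f (ψ w))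
    (hψ : HasDerivAt ψ ψ' w) : dz (fun x => f (ψ x)) w = dz f (ψ w) * ψ' := by
  have h : HasFDerivAt (fun x => f (ψ x)) _ w :=
    hf.hasFDerivAt.comp w (hψ.hasFDerivAt.restrictScalars ℝ)
  rw [dz_of_hasFDerivAt h]
  simp only [ContinuousLinearMap.comp_apply, ContinuousLinearMap.coe_restrictScalars',
    ContinuousLinearMap.toSpanSingleton_apply, smul_eq_mul, fderiv_apply_eq_dz_dzbar, map_mul,
    conj_I, one_mul]
  linear_combination (-(dz f (ψ w) * ψ') / 2 + dzbar f (ψ w) * conj ψ' / 2) * I_sq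

lemma dzbar_comp_holomorphic {f ψ : ℂ → ℂ} {ψ' w : ℂ} (hf : DifferentiableAt ℝ f (ψ w))
    (hψ : HasDerivAt ψ ψ' w) : dzbar (fun x => f (ψ x)) w = dzbar f (ψ w) * conj ψ' := by
  have h : HasFDerivAt (fun x => f (ψ x)) _ w :=
    hf.hasFDerivAt.comp w (hψ.hasFDerivAt.restrictScalars ℝ)
  rw [dzbar_of_hasFDerivAt h]
  simp only [ContinuousLinearMap.comp_apply, ContinuousLinearMap.coe_restrictScalars',
    ContinuousLinearMap.toSpanSingleton_apply, smul_eq_mul, fderiv_apply_eq_dz_dzbar, map_mul,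
    conj_I, one_mul]
  linear_combination ((dz f (ψ w) * ψ') / 2 - dzbar f (ψ w) * conj ψ' / 2) * I_sq

lemma dz_cexp {q : ℂ → ℂ} {w : ℂ} (hq : DifferentiableAt ℝ q w) :
    dz (fun x => cexp (q x)) w = cexp (q w) * dz q w := by
  rw [dz_of_hasFDerivAt hq.hasFDerivAt.cexp, dz]
  simp only [smul_apply, smul_eq_mul]
  ring

lemma dzbar_cexp {q : ℂ → ℂ} {w : ℂ} (hq : DifferentiableAt ℝ q w) :
    dzbar (fun x => cexp (q x)) w = cexp (q w) * dzbar q w := by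
  rw [dzbar_of_hasFDerivAt hq.hasFDerivAt.cexp, dzbar]
  simp only [smul_apply, smul_eq_mul]
  ring

/-- For a real-valued function the two Wirtinger derivatives are conjugate to each other. -/
lemma dzbar_ofReal {V : ℂ → ℝ} {w : ℂ} (hV : DifferentiableAt ℝ V w) :
    dzbar (fun x => (V x : ℂ)) w = conj (dz (fun x => (V x : ℂ)) w) := by
  have h : HasFDerivAt (fun x => (V x : ℂ)) (ofRealCLM.comp (fderiv ℝ V w)) w :=
    ofRealCLM.hasFDerivAt.comp w hV.hasFDerivAt
  rw [dzbar_of_hasFDerivAt h, dz_of_hasFDerivAt h]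
  simp [map_ofNat]

lemma dz_re (w : ℂ) : dz (fun x => (x.re : ℂ)) w = 1 / 2 := by
  have h : HasFDerivAt (fun x : ℂ => (x.re : ℂ)) (ofRealCLM.comp reCLM) w :=
    (ofRealCLM.comp reCLM).hasFDerivAt
  rw [dz_of_hasFDerivAt h]
  simp

lemma differentiableAt_neg_re (w : ℂ) :
    DifferentiableAt ℝ (fun x : ℂ => ((-x.re : ℝ) : ℂ)) w :=
  (ofRealCLM.comp (-reCLM)).differentiableAt

lemma dz_neg_re (w : ℂ) : dz (fun x => ((-x.re : ℝ) : ℂ)) w = -1 / 2 := by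
  have h : HasFDerivAt (fun x : ℂ => ((-x.re : ℝ) : ℂ)) (ofRealCLM.comp (-reCLM)) w :=
    (ofRealCLM.comp (-reCLM)).hasFDerivAt
  rw [dz_of_hasFDerivAt h]
  simp [neg_div]

lemma dzbar_neg_re (w : ℂ) : dzbar (fun x => ((-x.re : ℝ) : ℂ)) w = -1 / 2 := by
  have h : HasFDerivAt (fun x : ℂ => ((-x.re : ℝ) : ℂ)) (ofRealCLM.comp (-reCLM)) w :=
    (ofRealCLM.comp (-reCLM)).hasFDerivAt
  rw [dzbar_of_hasFDerivAt h]
  simp [neg_div]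

lemma contDiffAt_ofReal_comp {V : ℂ → ℝ} {w : ℂ} {n : WithTop ℕ∞} (hV : ContDiffAt ℝ n V w) :
    ContDiffAt ℝ n (fun x => (V x : ℂ)) w :=
  ofRealCLM.contDiff.contDiffAt.comp w hV

lemma contDiffAt_dz {f : ℂ → ℂ} {z : ℂ} (hf : ContDiffAt ℝ 2 f z) :
    ContDiffAt ℝ 1 (dz f) z := by
  have h := hf.fderiv_right (m := 1) (by norm_num)
  exact contDiffAt_const.mul ((h.clm_apply contDiffAt_const).sub
    (contDiffAt_const.mul (h.clm_apply contDiffAt_const)))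

lemma continuousAt_dz {f : ℂ → ℂ} {z : ℂ} (hf : ContDiffAt ℝ 1 f z) :
    ContinuousAt (dz f) z := by
  have h := (hf.fderiv_right (m := 0) (by norm_num)).continuousAt
  exact continuousAt_const.mul ((h.clm_apply continuousAt_const).sub
    (continuousAt_const.mul (h.clm_apply continuousAt_const)))

lemma continuousAt_dzbar {f : ℂ → ℂ} {z : ℂ} (hf : ContDiffAt ℝ 1 f z) :
    ContinuousAt (dzbar f) z := by
  have h := (hf.fderiv_right (m := 0) (by norm_num)).continuousAt
  exact continuousAt_const.mul ((h.clm_apply continuousAt_const).add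
    (continuousAt_const.mul (h.clm_apply continuousAt_const)))

lemma laplacian_eq_fderiv_fderiv {F : Type*} [NormedAddCommGroup F] [NormedSpace ℝ F]
    (f : ℂ → F) (w : ℂ) :
    Laplacian.laplacian f w = fderiv ℝ (fderiv ℝ f) w 1 1 + fderiv ℝ (fderiv ℝ f) w I I := by
  rw [laplacian_eq_iteratedFDeriv_complexPlane]
  simp [iteratedFDeriv_two_apply]

/-- `4 ∂_{z̄} ∂_z` is the Laplacian. -/
lemma dzbar_dz_eq_laplacian {f : ℂ → ℂ} {w : ℂ} (hf : ContDiffAt ℝ 2 f w) :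
    dzbar (dz f) w = Laplacian.laplacian f w / 4 := by
  have h := (hf.fderiv_right (m := 1) (by norm_num)).differentiableAt (by norm_num)
  have hv (v : ℂ) : HasFDerivAt (fun x => fderiv ℝ f x v)
      ((ContinuousLinearMap.apply ℝ ℂ v).comp (fderiv ℝ (fderiv ℝ f) w)) w :=
    (ContinuousLinearMap.apply ℝ ℂ v).hasFDerivAt.comp w h.hasFDerivAt
  have h1 : HasFDerivAt (dz f) _ w :=
    ((hv 1).sub ((hv I).const_mul I)).const_mul (1 / 2 : ℂ)
  have hs : fderiv ℝ (fderiv ℝ f) w 1 I = fderiv ℝ (fderiv ℝ f) w I 1 :=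
    (hf.isSymmSndFDerivAt (by simp)) 1 I
  rw [dzbar_of_hasFDerivAt h1, laplacian_eq_fderiv_fderiv]
  simp only [smul_apply, sub_apply,
    ContinuousLinearMap.comp_apply, ContinuousLinearMap.apply_apply, smul_eq_mul]
  linear_combination (-(1 / 4 : ℂ) * I) * hs - (fderiv ℝ (fderiv ℝ f) w I I / 4) * I_sq

lemma dzbar_dz_ofReal_eq_laplacian {V : ℂ → ℝ} {w : ℂ} (hV : ContDiffAt ℝ 2 V w) :
    dzbar (dz (fun x => (V x : ℂ))) w = ((Laplacian.laplacian V w / 4 : ℝ) : ℂ) := by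
  rw [dzbar_dz_eq_laplacian (contDiffAt_ofReal_comp hV)]
  have := hV.laplacian_CLM_comp_left (l := ofRealCLM)
  have h2 : (fun x => (V x : ℂ)) = ⇑ofRealCLM ∘ V := rfl
  rw [h2, this]
  simp

/-! ### Fourier modes on circles -/

/-- The (unnormalised) `n`-th Fourier coefficient of `θ ↦ g (c + r e^{iθ})`. -/
noncomputable def circleMode (g : ℂ → ℂ) (c : ℂ) (n : ℤ) (r : ℝ) : ℂ :=
  ∫ θ in (0 : ℝ)..2 * Real.pi, g (circleMap c r θ) * cexp (-(n * θ * I))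

lemma circleMap_mem_ball {c : ℂ} {r R : ℝ} (hr : |r| < R) (θ : ℝ) : circleMap c r θ ∈ ball c R := by
  rw [mem_ball, dist_eq, circleMap_sub_center, norm_circleMap_zero]
  exact hr

lemma norm_cexp_neg_int_mul_I (n : ℤ) (θ : ℝ) : ‖cexp (-(n * θ * I))‖ = 1 := by
  rw [show -((n : ℂ) * θ * I) = ((-(n * θ) : ℝ) : ℂ) * I by push_cast; ring]
  exact norm_exp_ofReal_mul_I _

lemma continuous_mode_integrand {g : ℂ → ℂ} {c : ℂ} {r R : ℝ} (n : ℤ)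
    (hg : ContinuousOn g (ball c R)) (hr : |r| < R) :
    Continuous fun θ : ℝ => g (circleMap c r θ) * cexp (-(n * θ * I)) := by
  refine (hg.comp_continuous (continuous_circleMap c r) (circleMap_mem_ball hr)).mul ?_
  fun_prop

lemma norm_circleMode_le {g : ℂ → ℂ} {c : ℂ} {n : ℤ} {r M : ℝ}
    (h : ∀ θ, ‖g (circleMap c r θ)‖ ≤ M) : ‖circleMode g c n r‖ ≤ 2 * Real.pi * M := by
  have := intervalIntegral.norm_integral_le_of_norm_le_const (a := 0) (b := 2 * Real.pi) (C := M)
    (f := fun θ : ℝ => g (circleMap c r θ) * cexp (-(n * θ * I))) (fun θ _ => by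
      rw [norm_mul, norm_cexp_neg_int_mul_I, mul_one]; exact h θ)
  rw [sub_zero, abs_of_pos Real.two_pi_pos] at this
  rw [circleMode]
  linarith

lemma circleMode_const (a c : ℂ) {n : ℤ} (hn : n ≠ 0) (r : ℝ) :
    circleMode (fun _ => a) c n r = 0 := by
  have h0 : (-(n * I) : ℂ) ≠ 0 := by simp [hn]
  have : ∀ θ : ℝ, a * cexp (-(n * θ * I)) = a * cexp (-(n * I) * θ) := fun θ => by ring_nf
  simp only [circleMode, this]
  rw [intervalIntegral.integral_const_mul, integral_exp_mul_complex h0]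
  have : cexp (-(n * I) * (2 * Real.pi : ℝ)) = 1 := by
    rw [exp_eq_one_iff]
    exact ⟨-n, by push_cast; ring⟩
  rw [this]
  simp

lemma circleMode_sub {f g : ℂ → ℂ} {c : ℂ} {r R : ℝ} (n : ℤ)
    (hf : ContinuousOn f (ball c R)) (hg : ContinuousOn g (ball c R)) (hr : |r| < R) :
    circleMode (fun z => f z - g z) c n r = circleMode f c n r - circleMode g c n r := by
  simp only [circleMode]
  rw [← intervalIntegral.integral_sub
    ((continuous_mode_integrand n hf hr).intervalIntegrable _ _)
    ((continuous_mode_integrand n hg hr).intervalIntegrable _ _)]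
  simp only [sub_mul]

lemma circleMode_sub_const {f : ℂ → ℂ} {c : ℂ} {r R : ℝ} {n : ℤ} (hn : n ≠ 0)
    (hf : ContinuousOn f (ball c R)) (a : ℂ) (hr : |r| < R) :
    circleMode (fun z => f z - a) c n r = circleMode f c n r := by
  rw [circleMode_sub n hf continuousOn_const hr, circleMode_const a c hn, sub_zero]

lemma continuousOn_dz {g : ℂ → ℂ} {s : Set ℂ} (hg : ∀ z ∈ s, ContDiffAt ℝ 1 g z) :
    ContinuousOn (dz g) s := fun z hz => (continuousAt_dz (hg z hz)).continuousWithinAt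

lemma continuousOn_dzbar {g : ℂ → ℂ} {s : Set ℂ} (hg : ∀ z ∈ s, ContDiffAt ℝ 1 g z) :
    ContinuousOn (dzbar g) s := fun z hz => (continuousAt_dzbar (hg z hz)).continuousWithinAt

lemma fderiv_circle_mode (g : ℂ → ℂ) (z : ℂ) (n : ℤ) (θ : ℝ) :
    fderiv ℝ g z (cexp (θ * I)) * cexp (-(n * θ * I)) =
      dz g z * cexp (-((n - 1 : ℤ) * θ * I)) + dzbar g z * cexp (-((n + 1 : ℤ) * θ * I)) := by
  have h1 : conj (cexp (θ * I)) = cexp (-(θ * I)) := by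
    rw [← exp_conj, map_mul, conj_ofReal, conj_I, mul_neg]
  rw [fderiv_apply_eq_dz_dzbar, h1, add_mul, mul_assoc (dz g z), mul_assoc (dzbar g z),
    ← exp_add, ← exp_add]
  push_cast
  ring_nf

lemma hasDerivAt_circleMap_radius (c : ℂ) (r θ : ℝ) :
    HasDerivAt (fun ρ : ℝ => circleMap c ρ θ) (cexp (θ * I)) r := by
  have := ((ofRealCLM.hasDerivAt (x := r)).mul_const (cexp (θ * I))).const_add c
  simpa [circleMap] using this

/-- Differentiation of a Fourier mode in the radius. -/
lemma hasDerivAt_circleMode {g : ℂ → ℂ} {c : ℂ} {r R : ℝ} (n : ℤ)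
    (hg : ∀ z ∈ ball c R, ContDiffAt ℝ 1 g z) (hr : |r| < R) :
    HasDerivAt (circleMode g c n)
      (circleMode (dz g) c (n - 1) r + circleMode (dzbar g) c (n + 1) r) r := by
  obtain ⟨R', h1, h2⟩ := exists_between hr
  have hgc : ContinuousOn g (ball c R) := fun z hz => (hg z hz).continuousAt.continuousWithinAt
  have hfc : ContinuousOn (fderiv ℝ g) (ball c R) := fun z hz =>
    ((hg z hz).fderiv_right (m := 0) (by norm_num)).continuousAt.continuousWithinAt
  obtain ⟨M, hM⟩ := (isCompact_closedBall c R').exists_bound_of_continuousOn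
    (hfc.mono (closedBall_subset_ball h2))
  have hnear : ∀ x ∈ ball r (R' - |r|), |x| < R' := fun x hx => by
    rw [mem_ball, Real.dist_eq] at hx
    have := abs_sub_abs_le_abs_sub x r
    linarith
  have hpt : ∀ θ : ℝ, ∀ x ∈ ball r (R' - |r|), circleMap c x θ ∈ ball c R := fun θ x hx =>
    circleMap_mem_ball ((hnear x hx).trans h2) θ
  have hcont' : Continuous fun θ : ℝ =>
      fderiv ℝ g (circleMap c r θ) (cexp (θ * I)) * cexp (-(n * θ * I)) := by
    refine ((hfc.comp_continuous (continuous_circleMap c r)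
      (circleMap_mem_ball hr)).clm_apply ?_).mul ?_ <;> fun_prop
  have key := (intervalIntegral.hasDerivAt_integral_of_dominated_loc_of_deriv_le
    (μ := volume) (a := 0) (b := 2 * Real.pi) (bound := fun _ => M)
    (F := fun (ρ θ : ℝ) => g (circleMap c ρ θ) * cexp (-(n * θ * I)))
    (F' := fun (ρ θ : ℝ) => fderiv ℝ g (circleMap c ρ θ) (cexp (θ * I)) * cexp (-(n * θ * I)))
    (ball_mem_nhds r (sub_pos.2 h1)) ?_
    ((continuous_mode_integrand n hgc hr).intervalIntegrable _ _)
    hcont'.aestronglyMeasurable ?_ intervalIntegrable_const ?_).2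
  · rw [circleMode, circleMode, ← intervalIntegral.integral_add
      ((continuous_mode_integrand _ (continuousOn_dz hg) hr).intervalIntegrable _ _)
      ((continuous_mode_integrand _ (continuousOn_dzbar hg) hr).intervalIntegrable _ _)]
    simp only [fderiv_circle_mode] at key
    exact key
  · filter_upwards [ball_mem_nhds r (sub_pos.2 h1)] with x hx
    exact (continuous_mode_integrand n hgc ((hnear x hx).trans h2)).aestronglyMeasurable
  · refine Eventually.of_forall fun θ _ x hx => ?_
    rw [norm_mul, norm_cexp_neg_int_mul_I, mul_one]
    refine (ContinuousLinearMap.le_opNorm _ _).trans ?_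
    rw [norm_exp_ofReal_mul_I, mul_one]
    exact hM _ (ball_subset_closedBall (circleMap_mem_ball (hnear x hx) θ))
  · refine Eventually.of_forall fun θ _ x hx => ?_
    have hd := ((hg _ (hpt θ x hx)).differentiableAt (by norm_num)).hasFDerivAt
    exact (hd.comp_hasDerivAt x (hasDerivAt_circleMap_radius c x θ)).mul_const _

/-- Integration by parts in the angular variable. -/
lemma circleMode_dz_sub_dzbar {g : ℂ → ℂ} {c : ℂ} {r R : ℝ} (n : ℤ)
    (hg : ∀ z ∈ ball c R, ContDiffAt ℝ 1 g z) (hr : |r| < R) :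
    r * (circleMode (dz g) c (n - 1) r - circleMode (dzbar g) c (n + 1) r) =
      n * circleMode g c n r := by
  have hgc : ContinuousOn g (ball c R) := fun z hz => (hg z hz).continuousAt.continuousWithinAt
  have c1 := continuous_mode_integrand (n - 1) (continuousOn_dz hg) hr
  have c2 := continuous_mode_integrand (n + 1) (continuousOn_dzbar hg) hr
  have c3 := continuous_mode_integrand n hgc hr
  have hder : ∀ θ : ℝ, HasDerivAt (fun θ : ℝ => g (circleMap c r θ) * cexp (-(n * θ * I)))
      (I * (r * (dz g (circleMap c r θ) * cexp (-((n - 1 : ℤ) * θ * I)) -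
        dzbar g (circleMap c r θ) * cexp (-((n + 1 : ℤ) * θ * I))) -
        n * (g (circleMap c r θ) * cexp (-(n * θ * I))))) θ := by
    intro θ
    have hd := ((hg _ (circleMap_mem_ball hr θ)).differentiableAt (by norm_num)).hasFDerivAt
    have h1 := hd.comp_hasDerivAt θ (hasDerivAt_circleMap c r θ)
    have h2 : HasDerivAt (fun θ : ℝ => cexp (-(n * θ * I)))
        (cexp (-(n * θ * I)) * (-(n * I))) θ := by
      have := ((((ofRealCLM.hasDerivAt (x := θ)).const_mul (n : ℂ)).mul_const I).neg).cexp
      simpa using this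
    refine (h1.mul h2).congr_deriv ?_
    have h3 : conj (cexp (θ * I)) = cexp (-(θ * I)) := by
      rw [← exp_conj, map_mul, conj_ofReal, conj_I, mul_neg]
    have e1 : cexp (-((n - 1 : ℤ) * θ * I)) = cexp (-(n * θ * I)) * cexp (θ * I) := by
      rw [← exp_add]; push_cast; ring_nf
    have e2 : cexp (-((n + 1 : ℤ) * θ * I)) = cexp (-(n * θ * I)) * cexp (-(θ * I)) := by
      rw [← exp_add]; push_cast; ring_nf
    rw [fderiv_apply_eq_dz_dzbar, circleMap_zero, map_mul, map_mul, h3, conj_ofReal, conj_I, e1, e2]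
    simp only [Function.comp_apply]
    ring
  have hint := intervalIntegral.integral_eq_sub_of_hasDerivAt (a := 0) (b := 2 * Real.pi)
    (fun θ _ => hder θ) (Continuous.intervalIntegrable (by fun_prop) _ _)
  have hper : g (circleMap c r (2 * Real.pi)) * cexp (-(n * (2 * Real.pi : ℝ) * I)) -
      g (circleMap c r 0) * cexp (-(n * (0 : ℝ) * I)) = 0 := by
    have : cexp (-(n * (2 * Real.pi : ℝ) * I)) = 1 := by
      rw [exp_eq_one_iff]
      exact ⟨-n, by push_cast; ring⟩
    rw [this]
    simp [circleMap]
  rw [hper, intervalIntegral.integral_const_mul, intervalIntegral.integral_sub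
    (Continuous.intervalIntegrable (by fun_prop) _ _)
    (Continuous.intervalIntegrable (by fun_prop) _ _), intervalIntegral.integral_const_mul,
    intervalIntegral.integral_const_mul, intervalIntegral.integral_sub
    (c1.intervalIntegrable _ _) (c2.intervalIntegrable _ _)] at hint
  have := (mul_eq_zero.1 hint).resolve_left I_ne_zero
  exact sub_eq_zero.1 this

/-- The mode equation `(r^{-n} a_n(g))' = 2 r^{-n} a_{n+1}(∂̄g)`. -/
lemma hasDerivAt_zpow_neg_mul_circleMode {g : ℂ → ℂ} {c : ℂ} {r R : ℝ} (n : ℤ)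
    (hg : ∀ z ∈ ball c R, ContDiffAt ℝ 1 g z) (h0 : 0 < r) (hr : r < R) :
    HasDerivAt (fun ρ : ℝ => (ρ : ℂ) ^ (-n) * circleMode g c n ρ)
      (2 * (r : ℂ) ^ (-n) * circleMode (dzbar g) c (n + 1) r) r := by
  have hr' : |r| < R := by rwa [abs_of_pos h0]
  have hr0 : (r : ℂ) ≠ 0 := ofReal_ne_zero.2 h0.ne'
  have h1 := ((hasDerivAt_zpow (-n) (r : ℂ) (.inl hr0)).comp_ofReal).mul
    (hasDerivAt_circleMode n hg hr')
  refine h1.congr_deriv ?_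
  have h2 := circleMode_dz_sub_dzbar n hg hr'
  rw [zpow_sub_one₀ hr0]
  push_cast
  field_simp
  linear_combination h2

/-- The mode equation `(r^n a_n(g))' = 2 r^n a_{n-1}(∂g)`. -/
lemma hasDerivAt_zpow_mul_circleMode {g : ℂ → ℂ} {c : ℂ} {r R : ℝ} (n : ℤ)
    (hg : ∀ z ∈ ball c R, ContDiffAt ℝ 1 g z) (h0 : 0 < r) (hr : r < R) :
    HasDerivAt (fun ρ : ℝ => (ρ : ℂ) ^ n * circleMode g c n ρ)
      (2 * (r : ℂ) ^ n * circleMode (dz g) c (n - 1) r) r := by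
  have hr' : |r| < R := by rwa [abs_of_pos h0]
  have hr0 : (r : ℂ) ≠ 0 := ofReal_ne_zero.2 h0.ne'
  have h1 := ((hasDerivAt_zpow n (r : ℂ) (.inl hr0)).comp_ofReal).mul
    (hasDerivAt_circleMode n hg hr')
  refine h1.congr_deriv ?_
  have h2 := circleMode_dz_sub_dzbar n hg hr'
  rw [zpow_sub_one₀ hr0]
  field_simp
  linear_combination -h2

/-! ### Interior derivative estimates -/

/-- If `‖Φ'(ρ)‖ ≤ B ρ^(a-1)` on `(0, R)` with `a > 0`, then `Φ` differs from its limit at `0` by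
at most `B r^a / a`. -/
lemma norm_sub_le_of_norm_deriv_le_rpow {Φ Φ' : ℝ → ℂ} {B a r R : ℝ} {l : ℂ} (ha : 0 < a)
    (h0 : 0 < r) (hr : r < R) (hd : ∀ ρ, 0 < ρ → ρ < R → HasDerivAt Φ (Φ' ρ) ρ)
    (hb : ∀ ρ, 0 < ρ → ρ < R → ‖Φ' ρ‖ ≤ B * ρ ^ (a - 1)) (hl : Tendsto Φ (𝓝[>] 0) (𝓝 l)) :
    ‖Φ r - l‖ ≤ B * r ^ a / a := by
  have hB : 0 ≤ B :=
    nonneg_of_mul_nonneg_left ((norm_nonneg _).trans (hb r h0 hr)) (Real.rpow_pos_of_pos h0 _)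
  have hs : ∀ s, 0 < s → s < r → ‖Φ r - Φ s‖ ≤ B * r ^ a / a := by
    intro s s0 sr
    have hbd : ∀ x : ℝ, 0 < x →
        HasDerivAt (fun x : ℝ => B / a * (x ^ a - s ^ a)) (B * x ^ (a - 1)) x := by
      intro x hx
      refine (((Real.hasDerivAt_rpow_const (.inl hx.ne')).sub_const _).const_mul _).congr_deriv ?_
      field_simp
    have hsub : ∀ x ∈ Set.Icc s r, HasDerivAt (fun x => Φ x - Φ s) (Φ' x) x := fun x hx =>
      (hd x (s0.trans_le hx.1) (hx.2.trans_lt hr)).sub_const _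
    have := image_norm_le_of_norm_deriv_right_le_deriv_boundary'
      (f := fun x => Φ x - Φ s) (f' := Φ') (a := s) (b := r)
      (B := fun x : ℝ => B / a * (x ^ a - s ^ a)) (B' := fun x => B * x ^ (a - 1))
      (fun x hx => (hsub x hx).continuousAt.continuousWithinAt)
      (fun x hx => (hsub x ⟨hx.1, hx.2.le⟩).hasDerivWithinAt) (by simp)
      (fun x hx => (hbd x (s0.trans_le hx.1)).continuousAt.continuousWithinAt)
      (fun x hx => (hbd x (s0.trans_le hx.1)).hasDerivWithinAt)
      (fun x hx => hb x (s0.trans_le hx.1) (hx.2.trans hr)) (Set.right_mem_Icc.2 sr.le)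
    refine this.trans ?_
    rw [mul_div_right_comm]
    exact mul_le_mul_of_nonneg_left (sub_le_self _ (Real.rpow_nonneg s0.le _)) (by positivity)
  refine le_of_tendsto ((tendsto_const_nhds.sub hl).norm) ?_
  filter_upwards [Ioo_mem_nhdsGT h0] with s hs'
  exact hs s hs'.1 hs'.2

lemma circleMode_zero_radius_zero (g : ℂ → ℂ) (c : ℂ) :
    circleMode g c 0 0 = 2 * Real.pi * g c := by
  simp [circleMode]

lemma circleMode_zero_radius {g : ℂ → ℂ} {c : ℂ} {n : ℤ} (hn : n ≠ 0) :
    circleMode g c n 0 = 0 := by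
  have := circleMode_const (g c) c hn 0
  simpa [circleMode] using this

lemma tendsto_circleMode_zero {g : ℂ → ℂ} {c : ℂ} {R : ℝ} (hR : 0 < R)
    (hg : ∀ z ∈ ball c R, ContDiffAt ℝ 1 g z) :
    Tendsto (circleMode g c 0) (𝓝[>] 0) (𝓝 (2 * Real.pi * g c)) := by
  rw [← circleMode_zero_radius_zero]
  exact ((hasDerivAt_circleMode 0 hg (by simpa)).continuousAt).continuousWithinAt

lemma tendsto_mul_circleMode {g : ℂ → ℂ} {c : ℂ} {R : ℝ} (n : ℤ) (hR : 0 < R)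
    (hg : ∀ z ∈ ball c R, ContDiffAt ℝ 1 g z) :
    Tendsto (fun ρ : ℝ => (ρ : ℂ) * circleMode g c n ρ) (𝓝[>] 0) (𝓝 0) := by
  have h : ContinuousAt (fun ρ : ℝ => (ρ : ℂ) * circleMode g c n ρ) 0 :=
    continuous_ofReal.continuousAt.mul (hasDerivAt_circleMode n hg (by simpa)).continuousAt
  simpa using h.continuousWithinAt.tendsto

/-- The first Fourier mode is asymptotic to `2 π r ∂g(c)`. -/
lemma tendsto_inv_mul_circleMode_one {g : ℂ → ℂ} {c : ℂ} {R : ℝ} (hR : 0 < R)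
    (hg : ∀ z ∈ ball c R, ContDiffAt ℝ 1 g z) :
    Tendsto (fun ρ : ℝ => (ρ : ℂ) ^ (-1 : ℤ) * circleMode g c 1 ρ) (𝓝[>] 0)
      (𝓝 (2 * Real.pi * dz g c)) := by
  have h := hasDerivAt_circleMode 1 hg (r := 0) (by simpa)
  rw [show (1 : ℤ) - 1 = 0 by norm_num, show (1 : ℤ) + 1 = 2 by norm_num,
    circleMode_zero_radius_zero, circleMode_zero_radius (by norm_num), add_zero] at h
  have h2 := h.tendsto_slope_zero_right
  simpa [circleMode_zero_radius] using h2

lemma norm_two_mul_zpow_mul_circleMode_le {g : ℂ → ℂ} {c : ℂ} {n : ℤ} {ρ R M : ℝ} (m : ℤ)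
    (h0 : 0 < ρ) (hρ : ρ < R) (h : ∀ z ∈ ball c R, ‖g z‖ ≤ M) :
    ‖2 * (ρ : ℂ) ^ m * circleMode g c n ρ‖ ≤ 4 * Real.pi * M * ρ ^ ((m + 1 : ℝ) - 1) := by
  have h1 : ‖circleMode g c n ρ‖ ≤ 2 * Real.pi * M := norm_circleMode_le fun θ =>
    h _ (circleMap_mem_ball (by rwa [abs_of_pos h0]) θ)
  rw [norm_mul, norm_mul, norm_zpow, norm_real, Real.norm_of_nonneg h0.le, add_sub_cancel_right,
    Real.rpow_intCast, RCLike.norm_ofNat]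
  have := mul_le_mul_of_nonneg_left h1 (zpow_pos h0 m).le
  linarith

/-- Mean value estimate: the circle average of `v` differs from `v c` by at most `G r ^ 2`
if `|∂_{z̄} ∂_z v| ≤ G`. -/
lemma norm_circleMode_zero_sub_le {v : ℂ → ℂ} {c : ℂ} {r R G : ℝ}
    (hv : ∀ z ∈ ball c R, ContDiffAt ℝ 2 v z) (hG : ∀ z ∈ ball c R, ‖dzbar (dz v) z‖ ≤ G)
    (h0 : 0 < r) (hr : r < R) :
    ‖circleMode v c 0 r - 2 * Real.pi * v c‖ ≤ 2 * Real.pi * G * r ^ 2 := by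
  have hR := h0.trans hr
  have hv1 : ∀ z ∈ ball c R, ContDiffAt ℝ 1 v z := fun z hz => (hv z hz).of_le (by norm_num)
  have hd : ∀ z ∈ ball c R, ContDiffAt ℝ 1 (dz v) z := fun z hz => contDiffAt_dz (hv z hz)
  have step1 : ∀ ρ, 0 < ρ → ρ < R → ‖(ρ : ℂ) * circleMode (dz v) c (-1) ρ‖ ≤
      2 * Real.pi * G * ρ ^ 2 := by
    intro ρ h1 h2
    have := norm_sub_le_of_norm_deriv_le_rpow
      (Φ := fun ρ : ℝ => (ρ : ℂ) * circleMode (dz v) c (-1) ρ)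
      (a := (1 : ℤ) + 1) (by norm_num) h1 h2
      (fun ρ a b => by simpa using hasDerivAt_zpow_neg_mul_circleMode (-1) hd a b)
      (fun ρ a b => by
        simpa using norm_two_mul_zpow_mul_circleMode_le (n := 0) 1 a b hG)
      (tendsto_mul_circleMode (-1) hR hd)
    norm_num at this
    rw [abs_of_pos h1] at this
    rw [norm_mul, norm_real, Real.norm_of_nonneg h1.le]
    linarith
  have := norm_sub_le_of_norm_deriv_le_rpow (Φ := circleMode v c 0)
    (a := 2) (B := 4 * Real.pi * G) (by norm_num) h0 hr
    (fun ρ a b => by simpa using hasDerivAt_zpow_mul_circleMode 0 hv1 a b)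
    (fun ρ a b => by
      have := step1 ρ a b
      rw [norm_mul, norm_real, Real.norm_of_nonneg a.le] at this
      norm_num
      refine le_of_mul_le_mul_left ?_ a
      linarith)
    (tendsto_circleMode_zero hR hv1)
  norm_num at this
  linarith

/-- Interior gradient estimate in terms of the first Fourier mode and a bound for the
Laplacian. -/
lemma norm_dz_le {v : ℂ → ℂ} {c : ℂ} {r R G : ℝ}
    (hv : ∀ z ∈ ball c R, ContDiffAt ℝ 2 v z) (hG : ∀ z ∈ ball c R, ‖dzbar (dz v) z‖ ≤ G)
    (h0 : 0 < r) (hr : r < R) :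
    ‖dz v c‖ ≤ ‖circleMode v c 1 r‖ / (2 * Real.pi * r) + 4 / 3 * G * r := by
  have hR := h0.trans hr
  have hv1 : ∀ z ∈ ball c R, ContDiffAt ℝ 1 v z := fun z hz => (hv z hz).of_le (by norm_num)
  have hd : ∀ z ∈ ball c R, ContDiffAt ℝ 1 (dz v) z := fun z hz => contDiffAt_dz (hv z hz)
  have step1 : ∀ ρ, 0 < ρ → ρ < R → ‖circleMode (dz v) c 0 ρ - 2 * Real.pi * dz v c‖ ≤
      4 * Real.pi * G * ρ := by
    intro ρ h1 h2
    have := norm_sub_le_of_norm_deriv_le_rpow (Φ := circleMode (dz v) c 0)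
      (a := (0 : ℤ) + 1) (by norm_num) h1 h2
      (fun ρ a b => by simpa using hasDerivAt_zpow_neg_mul_circleMode 0 hd a b)
      (fun ρ a b => by
        simpa using norm_two_mul_zpow_mul_circleMode_le (n := 1) 0 a b hG)
      (tendsto_circleMode_zero hR hd)
    norm_num at this
    linarith
  have hder : ∀ ρ, 0 < ρ → ρ < R → HasDerivAt
      (fun ρ : ℝ => (ρ : ℂ) * circleMode v c 1 ρ - 2 * Real.pi * dz v c * ((ρ : ℂ) * ρ))
      (2 * ρ * (circleMode (dz v) c 0 ρ - 2 * Real.pi * dz v c)) ρ := by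
    intro ρ a b
    have h1 : HasDerivAt (fun ρ : ℝ => (ρ : ℂ) * circleMode v c 1 ρ)
        (2 * ρ * circleMode (dz v) c 0 ρ) ρ := by
      simpa using hasDerivAt_zpow_mul_circleMode 1 hv1 a b
    have h2 : HasDerivAt (fun ρ : ℝ => (ρ : ℂ)) 1 ρ := ofRealCLM.hasDerivAt
    refine (h1.sub ((h2.mul h2).const_mul (2 * Real.pi * dz v c))).congr_deriv ?_
    ring
  have hlim : Tendsto
      (fun ρ : ℝ => (ρ : ℂ) * circleMode v c 1 ρ - 2 * Real.pi * dz v c * ((ρ : ℂ) * ρ))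
      (𝓝[>] 0) (𝓝 0) := by
    have h2 : Tendsto (fun ρ : ℝ => 2 * Real.pi * dz v c * ((ρ : ℂ) * ρ)) (𝓝[>] 0)
        (𝓝 (2 * Real.pi * dz v c * (((0 : ℝ) : ℂ) * (0 : ℝ)))) :=
      (Continuous.tendsto (by fun_prop) 0).mono_left nhdsWithin_le_nhds
    simpa using (tendsto_mul_circleMode 1 hR hv1).sub h2
  have := norm_sub_le_of_norm_deriv_le_rpow (a := 3) (B := 8 * Real.pi * G) (by norm_num) h0 hr
    hder (fun ρ a b => by
      rw [norm_mul, norm_mul, norm_real, Real.norm_of_nonneg a.le, RCLike.norm_ofNat]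
      have := mul_le_mul_of_nonneg_left (step1 ρ a b) (by positivity : 0 ≤ 2 * ρ)
      norm_num
      linarith) hlim
  rw [sub_zero] at this
  norm_num at this
  have hpi := Real.pi_pos
  have e : ‖2 * Real.pi * dz v c * ((r : ℂ) * r)‖ = 2 * Real.pi * r ^ 2 * ‖dz v c‖ := by
    simp [abs_of_pos hpi]; ring
  have e2 : ‖(r : ℂ) * circleMode v c 1 r‖ = r * ‖circleMode v c 1 r‖ := by
    simp [abs_of_pos h0]
  have h3 := norm_sub_norm_le (2 * Real.pi * dz v c * ((r : ℂ) * r)) ((r : ℂ) * circleMode v c 1 r)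
  rw [norm_sub_rev, e, e2] at h3
  have h4 : 2 * Real.pi * r ^ 2 * ‖dz v c‖ ≤ 2 * Real.pi * r ^ 2 *
      (‖circleMode v c 1 r‖ / (2 * Real.pi * r) + 4 / 3 * G * r) := by
    have : 2 * Real.pi * r ^ 2 * (‖circleMode v c 1 r‖ / (2 * Real.pi * r) + 4 / 3 * G * r) =
      r * ‖circleMode v c 1 r‖ + 8 * Real.pi * G * r ^ 3 / 3 := by field_simp; ring
    rw [this]
    linarith
  exact le_of_mul_le_mul_left h4 (by positivity)

/-- Interior Hölder estimate: the `∂_z`-derivative of `g` at the centre is controlled by the size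
of `g` and the Hölder modulus of `∂_{z̄} g` at the centre. -/
lemma norm_dz_le_of_dzbar_holder {g : ℂ → ℂ} {c : ℂ} {r R M A ν : ℝ} (hν : 0 < ν)
    (hg : ∀ z ∈ ball c R, ContDiffAt ℝ 1 g z) (hM : ∀ z ∈ ball c R, ‖g z‖ ≤ M)
    (hA : ∀ z ∈ ball c R, ‖dzbar g z - dzbar g c‖ ≤ A * ‖z - c‖ ^ ν)
    (h0 : 0 < r) (hr : r < R) :
    ‖dz g c‖ ≤ M / r + 2 * A * r ^ ν / ν := by
  have hR := h0.trans hr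
  have hpi := Real.pi_pos
  have := norm_sub_le_of_norm_deriv_le_rpow (a := ν) (B := 4 * Real.pi * A) hν h0 hr
    (fun ρ a b => hasDerivAt_zpow_neg_mul_circleMode 1 hg a b)
    (fun ρ a b => by
      have hρ : |ρ| < R := by rwa [abs_of_pos a]
      -- subtracting a constant does not change the second Fourier mode
      rw [← circleMode_sub_const (by norm_num) (continuousOn_dzbar hg) (dzbar g c) hρ]
      have h1 : ‖circleMode (fun z => dzbar g z - dzbar g c) c (1 + 1) ρ‖ ≤
          2 * Real.pi * (A * ρ ^ ν) := norm_circleMode_le fun θ => by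
        refine (hA _ (circleMap_mem_ball hρ θ)).trans_eq ?_
        rw [circleMap_sub_center, norm_circleMap_zero, abs_of_pos a]
      rw [norm_mul, norm_mul, norm_zpow, norm_real, Real.norm_of_nonneg a.le, RCLike.norm_ofNat,
        Real.rpow_sub_one a.ne', zpow_neg_one]
      have := mul_le_mul_of_nonneg_left h1 (inv_pos.2 a).le
      rw [div_eq_mul_inv]
      linarith)
    (tendsto_inv_mul_circleMode_one hR hg)
  have h3 := norm_sub_norm_le (2 * Real.pi * dz g c) ((r : ℂ) ^ (-1 : ℤ) * circleMode g c 1 r)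
  rw [norm_sub_rev] at h3
  have e : ‖2 * Real.pi * dz g c‖ = 2 * Real.pi * ‖dz g c‖ := by simp [abs_of_pos hpi]
  have e2 : ‖(r : ℂ) ^ (-1 : ℤ) * circleMode g c 1 r‖ ≤ r⁻¹ * (2 * Real.pi * M) := by
    rw [norm_mul, norm_zpow, norm_real, Real.norm_of_nonneg h0.le, zpow_neg_one]
    exact mul_le_mul_of_nonneg_left (norm_circleMode_le fun θ =>
      hM _ (circleMap_mem_ball (by rwa [abs_of_pos h0]) θ)) (inv_pos.2 h0).le
  have h4 : 2 * Real.pi * ‖dz g c‖ ≤ 2 * Real.pi * (M / r + 2 * A * r ^ ν / ν) := by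
    have : 2 * Real.pi * (M / r + 2 * A * r ^ ν / ν) =
      r⁻¹ * (2 * Real.pi * M) + 4 * Real.pi * A * r ^ ν / ν := by field_simp; ring
    rw [this]
    linarith
  exact le_of_mul_le_mul_left h4 (by positivity)

/-! ### Maximum principle on periodic strips -/

lemma second_deriv_nonpos_of_isLocalMax {f f' : ℝ → ℝ} {a x : ℝ}
    (hf : ∀ᶠ y in 𝓝 x, HasDerivAt f (f' y) y) (hf' : HasDerivAt f' a x) (hx : IsLocalMax f x) :
    a ≤ 0 := by
  by_contra! ha
  have he : deriv f =ᶠ[𝓝 x] f' := hf.mono fun y hy => hy.deriv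
  have hdd : deriv (deriv f) x = a := by rw [he.deriv_eq, hf'.deriv]
  have hmin := isLocalMin_of_deriv_deriv_pos (hdd ▸ ha) hx.deriv_eq_zero
    hf.self_of_nhds.continuousAt
  -- a point that is both a local maximum and a local minimum makes `f` locally constant
  have hconst : f =ᶠ[𝓝 x] fun _ => f x := by
    filter_upwards [hmin, hx] with y h1 h2 using le_antisymm h2 h1
  have h0 : deriv f =ᶠ[𝓝 x] fun _ => 0 := by
    simpa using hconst.deriv
  rw [h0.deriv_eq, deriv_const] at hdd
  exact ha.ne hdd

lemma hasDerivAt_add_mul_ofReal (w v : ℂ) (s : ℝ) : HasDerivAt (fun s : ℝ => w + s * v) v s := by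
  simpa using ((ofRealCLM.hasDerivAt (x := s)).mul_const v).const_add w

lemma tendsto_add_mul_ofReal_zero (w v : ℂ) : Tendsto (fun s : ℝ => w + s * v) (𝓝 0) (𝓝 w) := by
  simpa using (hasDerivAt_add_mul_ofReal w v 0).continuousAt.tendsto

lemma eventually_hasDerivAt_line {V : ℂ → ℝ} {w : ℂ} (hV : ContDiffAt ℝ 2 V w) (v : ℂ) :
    ∀ᶠ s : ℝ in 𝓝 0,
      HasDerivAt (fun s : ℝ => V (w + s * v)) (fderiv ℝ V (w + s * v) v) s := by
  have h := (tendsto_add_mul_ofReal_zero w v).eventually (hV.eventually (by simp))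
  filter_upwards [h] with s hs
  exact (hs.differentiableAt (by norm_num)).hasFDerivAt.comp_hasDerivAt s
    (hasDerivAt_add_mul_ofReal w v s)

lemma hasDerivAt_fderiv_line {V : ℂ → ℝ} {w : ℂ} (hV : ContDiffAt ℝ 2 V w) (v : ℂ) :
    HasDerivAt (fun s : ℝ => fderiv ℝ V (w + s * v) v) (fderiv ℝ (fderiv ℝ V) w v v) 0 := by
  have h := (hV.fderiv_right (m := 1) (by norm_num)).differentiableAt (by norm_num)
  have h2 : HasFDerivAt (fun x => fderiv ℝ V x v)
      ((ContinuousLinearMap.apply ℝ ℝ v).comp (fderiv ℝ (fderiv ℝ V) w)) (w + (0 : ℝ) * v) := by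
    rw [show w + ((0 : ℝ) : ℂ) * v = w by simp]
    exact (ContinuousLinearMap.apply ℝ ℝ v).hasFDerivAt.comp w h.hasFDerivAt
  exact h2.comp_hasDerivAt (0 : ℝ) (hasDerivAt_add_mul_ofReal w v 0)

/-- Where `V` minus a function `φ` of the real part has a local maximum, `ΔV ≤ φ''`. -/
lemma laplacian_le_of_isLocalMax_sub_re {V : ℂ → ℝ} {φ φ' : ℝ → ℝ} {a : ℝ} {w : ℂ}
    (hV : ContDiffAt ℝ 2 V w) (hφ : ∀ᶠ x in 𝓝 w.re, HasDerivAt φ (φ' x) x)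
    (hφ' : HasDerivAt φ' a w.re) (hmax : IsLocalMax (fun z => V z - φ z.re) w) :
    Laplacian.laplacian V w ≤ a := by
  have hline (v : ℂ) : IsLocalMax (fun s : ℝ => V (w + s * v) - φ (w + s * v).re) 0 := by
    have := (tendsto_add_mul_ofReal_zero w v).eventually hmax
    simpa [IsLocalMax, IsMaxFilter] using this
  have h1 : fderiv ℝ (fderiv ℝ V) w 1 1 - a ≤ 0 := by
    have hs : Tendsto (fun s : ℝ => w.re + s) (𝓝 0) (𝓝 w.re) := by
      simpa using (continuous_const_add w.re).tendsto (0 : ℝ)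
    refine second_deriv_nonpos_of_isLocalMax (x := 0)
      (f := fun s : ℝ => V (w + s * 1) - φ (w.re + s))
      (f' := fun s : ℝ => fderiv ℝ V (w + s * 1) 1 - φ' (w.re + s)) ?_ ?_ ?_
    · filter_upwards [eventually_hasDerivAt_line hV 1, hs hφ] with s h1 h2
      exact h1.sub (HasDerivAt.comp_const_add w.re s h2)
    · refine (hasDerivAt_fderiv_line hV 1).sub (HasDerivAt.comp_const_add w.re 0 ?_)
      simpa using hφ'
    · simpa using hline 1
  have h2 : fderiv ℝ (fderiv ℝ V) w I I ≤ 0 := by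
    refine second_deriv_nonpos_of_isLocalMax (x := 0)
      (f := fun s : ℝ => V (w + s * I) - φ w.re)
      (f' := fun s : ℝ => fderiv ℝ V (w + s * I) I) ?_ (hasDerivAt_fderiv_line hV I) ?_
    · filter_upwards [eventually_hasDerivAt_line hV I] with s h1
      exact h1.sub_const _
    · simpa using hline I
  rw [laplacian_eq_fderiv_fderiv]
  linarith

/-- A continuous `2πi`-periodic function attains its maximum on a closed vertical strip. -/
lemma exists_isMax_strip {Q : ℂ → ℝ} {a b : ℝ} (hab : a ≤ b)
    (hQ : ContinuousOn Q {w | a ≤ w.re ∧ w.re ≤ b})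
    (hper : Function.Periodic Q (2 * Real.pi * I)) :
    ∃ w₀ : ℂ, a ≤ w₀.re ∧ w₀.re ≤ b ∧ ∀ w : ℂ, a ≤ w.re → w.re ≤ b → Q w ≤ Q w₀ := by
  have hcpt : IsCompact (Set.Icc a b ×ℂ Set.Icc 0 (2 * Real.pi)) :=
    isCompact_Icc.reProdIm isCompact_Icc
  have hne : (Set.Icc a b ×ℂ Set.Icc 0 (2 * Real.pi)).Nonempty :=
    ⟨(a : ℂ), by simp [mem_reProdIm, hab, Real.pi_pos.le]⟩
  obtain ⟨w₀, hw₀, hmax⟩ := hcpt.exists_isMaxOn hne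
    (hQ.mono fun w hw => (mem_reProdIm.1 hw).1)
  refine ⟨w₀, (mem_reProdIm.1 hw₀).1.1, (mem_reProdIm.1 hw₀).1.2, fun w h1 h2 => ?_⟩
  set n : ℤ := ⌊w.im / (2 * Real.pi)⌋
  have hn : Q (w - n • (2 * Real.pi * I)) = Q w := hper.sub_zsmul_eq n
  rw [← hn]
  have hpi := Real.two_pi_pos
  refine hmax (mem_reProdIm.2 ⟨?_, ?_⟩)
  · simpa using ⟨h1, h2⟩
  · have e : (w - n • (2 * Real.pi * I)).im = w.im - n * (2 * Real.pi) := by simp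
    have l1 := (le_div_iff₀ hpi).1 (Int.floor_le (w.im / (2 * Real.pi)))
    have l2 := (div_lt_iff₀ hpi).1 (Int.lt_floor_add_one (w.im / (2 * Real.pi)))
    rw [Set.mem_Icc, e]
    constructor <;> linarith

/-! ### Bounds from comparison with cusp metrics -/

/-- Ahlfors-type upper bound: a solution of `ΔV ≥ k e^{2V}` on the half-plane `re w ≤ -T` lies
below the density of the complete metric of curvature `-k`. -/
lemma sqrt_mul_exp_mul_le_one {V : ℂ → ℝ} {T k : ℝ} (hk : 0 < k)
    (hV : ∀ w : ℂ, w.re ≤ -T → ContDiffAt ℝ 2 V w)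
    (hper : Function.Periodic V (2 * Real.pi * I))
    (hΔ : ∀ w : ℂ, w.re ≤ -T → k * Real.exp (2 * V w) ≤ Laplacian.laplacian V w)
    {w : ℂ} (hw : w.re < -T) :
    √k * Real.exp (V w) * (-w.re - T) ≤ 1 := by
  set τ := -w.re - T with hτ
  have hτ0 : 0 < τ := by linarith
  have key : ∀ ℓ, τ < ℓ → √k * Real.exp (V w) * τ * (1 - τ / ℓ) ≤ 1 := by
    intro ℓ hℓ
    have hℓ0 : 0 < ℓ := hτ0.trans hℓ
    -- `e^V` divided by the supersolution `1/τ + 1/(ℓ-τ)`, which blows up at both edges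
    set Q : ℂ → ℝ := fun z => Real.exp (V z) * ((-z.re - T) * (ℓ - (-z.re - T))) with hQ
    obtain ⟨w₀, h1, h2, hmax⟩ := exists_isMax_strip (Q := Q) (a := -T - ℓ) (b := -T) (by linarith)
      (by
        refine ContinuousOn.mul (fun z hz => ?_) (by fun_prop)
        exact (hV z hz.2).continuousAt.rexp.continuousWithinAt)
      (by
        intro z
        simp only [hQ]
        rw [hper z]
        simp)
    have hQw : 0 < Q w := by
      have : 0 < ℓ - τ := by linarith
      simp only [hQ, ← hτ]
      positivity
    have hle : Q w ≤ Q w₀ := hmax w (by linarith) hw.le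
    have hQ0 : 0 < (-w₀.re - T) * (ℓ - (-w₀.re - T)) :=
      pos_of_mul_pos_right (hQw.trans_le hle) (Real.exp_pos _).le
    have hτ1 : 0 < -w₀.re - T := by
      refine lt_of_le_of_ne (by linarith) fun h => ?_
      rw [← h] at hQ0
      simp at hQ0
    have hτ2 : 0 < ℓ - (-w₀.re - T) := pos_of_mul_pos_right hQ0 hτ1.le
    have hΔ0 := laplacian_le_of_isLocalMax_sub_re (V := V) (w := w₀)
      (φ := fun x => -Real.log (-x - T) - Real.log (ℓ - (-x - T)))
      (φ' := fun x => (-x - T)⁻¹ - (ℓ - (-x - T))⁻¹)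
      (a := ((-w₀.re - T) ^ 2)⁻¹ + ((ℓ - (-w₀.re - T)) ^ 2)⁻¹) (hV _ h2) ?_ ?_ ?_
    · have hs := (hΔ w₀ h2).trans hΔ0
      set α := -w₀.re - T
      set β := ℓ - α with hβ
      have hαβ : (α ^ 2)⁻¹ + (β ^ 2)⁻¹ ≤ (ℓ / (α * β)) ^ 2 := by
        have : ℓ = α + β := by rw [hβ]; ring
        rw [this, div_pow, le_div_iff₀ (by positivity)]
        have : ((α ^ 2)⁻¹ + (β ^ 2)⁻¹) * (α * β) ^ 2 = α ^ 2 + β ^ 2 := by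
          field_simp
          ring
        rw [this]
        nlinarith [mul_pos hτ1 hτ2]
      have h3 : (√k * Real.exp (V w₀)) ^ 2 ≤ (ℓ / (α * β)) ^ 2 := by
        rw [mul_pow, Real.sq_sqrt hk.le, ← Real.exp_nat_mul]
        exact_mod_cast hs.trans hαβ
      have h4 := le_of_sq_le_sq h3 (by positivity)
      rw [le_div_iff₀ hQ0] at h4
      have h5 : √k * Q w ≤ ℓ :=
        (mul_le_mul_of_nonneg_left hle (Real.sqrt_nonneg k)).trans (by
          simp only [hQ]; linarith)
      have h6 : √k * Real.exp (V w) * τ * (1 - τ / ℓ) = √k * Q w / ℓ := by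
        simp only [hQ, ← hτ]
        field_simp
      rw [h6, div_le_one hℓ0]
      exact h5
    · have e1 : ∀ᶠ x in 𝓝 w₀.re, 0 < -x - T :=
        (Continuous.tendsto (by fun_prop : Continuous fun x : ℝ => -x - T) _).eventually
          (lt_mem_nhds hτ1)
      have e2 : ∀ᶠ x in 𝓝 w₀.re, 0 < ℓ - (-x - T) :=
        (Continuous.tendsto (by fun_prop : Continuous fun x : ℝ => ℓ - (-x - T)) _).eventually
          (lt_mem_nhds hτ2)
      filter_upwards [e1, e2] with x hx1 hx2
      have d1 : HasDerivAt (fun x : ℝ => -x - T) (-1) x := (hasDerivAt_neg x).sub_const T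
      refine ((d1.log hx1.ne').neg.sub ((d1.const_sub ℓ).log hx2.ne')).congr_deriv ?_
      field_simp
    · have d1 : HasDerivAt (fun x : ℝ => -x - T) (-1) w₀.re := (hasDerivAt_neg _).sub_const T
      refine ((d1.inv hτ1.ne').sub ((d1.const_sub ℓ).inv hτ2.ne')).congr_deriv ?_
      field_simp
      ring
    · have e1 : ∀ᶠ z : ℂ in 𝓝 w₀, 0 < -z.re - T :=
        (Continuous.tendsto (by fun_prop : Continuous fun z : ℂ => -z.re - T) _).eventually
          (lt_mem_nhds hτ1)
      have e2 : ∀ᶠ z : ℂ in 𝓝 w₀, 0 < ℓ - (-z.re - T) :=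
        (Continuous.tendsto (by fun_prop : Continuous fun z : ℂ => ℓ - (-z.re - T)) _).eventually
          (lt_mem_nhds hτ2)
      have hlog : ∀ z : ℂ, 0 < -z.re - T → 0 < ℓ - (-z.re - T) →
          V z - (-Real.log (-z.re - T) - Real.log (ℓ - (-z.re - T))) = Real.log (Q z) := by
        intro z hz1 hz2
        simp only [hQ]
        rw [Real.log_mul (Real.exp_pos _).ne' (mul_pos hz1 hz2).ne', Real.log_exp,
          Real.log_mul hz1.ne' hz2.ne']
        ring
      filter_upwards [e1, e2] with z hz1 hz2
      rw [hlog z hz1 hz2, hlog w₀ hτ1 hτ2]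
      exact Real.log_le_log (mul_pos (Real.exp_pos _) (mul_pos hz1 hz2))
        (hmax z (by linarith) (by linarith))
  have hlim : Tendsto (fun ℓ : ℝ => √k * Real.exp (V w) * τ * (1 - τ / ℓ)) atTop
      (𝓝 (√k * Real.exp (V w) * τ * (1 - 0))) :=
    tendsto_const_nhds.mul (tendsto_const_nhds.sub (tendsto_const_nhds.div_atTop tendsto_id))
  rw [sub_zero, mul_one] at hlim
  exact le_of_tendsto hlim ((eventually_gt_atTop τ).mono key)

/-- Lower bound: a solution of `ΔV ≤ k e^{2V}` on the half-plane `re w ≤ -T` that decays slower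
than any linear function dominates the density of a cusp metric of curvature `-k`. -/
lemma exists_one_le_sqrt_mul_exp_mul {V : ℂ → ℝ} {T k : ℝ} (hk : 0 < k)
    (hV : ∀ w : ℂ, w.re ≤ -T → ContDiffAt ℝ 2 V w)
    (hper : Function.Periodic V (2 * Real.pi * I))
    (hΔ : ∀ w : ℂ, w.re ≤ -T → Laplacian.laplacian V w ≤ k * Real.exp (2 * V w))
    (hlow : ∀ η > 0, ∃ b, ∀ w : ℂ, w.re ≤ -b → η * w.re ≤ V w) :
    ∃ B : ℝ, ∀ w : ℂ, w.re ≤ -T → 0 < B - w.re ∧ 1 ≤ √k * Real.exp (V w) * (B - w.re) := by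
  have hk' : 0 < √k := Real.sqrt_pos.2 hk
  obtain ⟨w₁, h1, h2, hmin⟩ := exists_isMax_strip (Q := fun w => -V w) (a := -T) (b := -T) le_rfl
    (fun z hz => (hV z hz.2).continuousAt.neg.continuousWithinAt)
    (fun z => by simp only [hper z])
  -- `B` makes the comparison function equal to the minimum of `V` on the line `re w = -T`
  set m := V w₁
  set B := Real.exp (-m) / √k - T with hB
  have hBT : 0 < B + T := by rw [hB]; simp only [sub_add_cancel]; positivity
  have hpos : ∀ w : ℂ, w.re ≤ -T → 0 < B - w.re := fun w hw => by linarith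
  set h : ℝ → ℝ := fun x => -Real.log (B - x) - Real.log √k with hh
  have hhT : h (-T) = m := by
    simp only [hh, sub_neg_eq_add]
    rw [hB, sub_add_cancel, Real.log_div (Real.exp_pos _).ne' hk'.ne', Real.log_exp]
    ring
  have hhle : ∀ x, x ≤ -T → h x ≤ m := fun x hx => by
    rw [← hhT]
    simp only [hh]
    have := Real.log_le_log (by linarith : 0 < B - -T) (by linarith : B - -T ≤ B - x)
    linarith
  have key : ∀ w : ℂ, w.re ≤ -T → ∀ η > 0, h w.re - V w ≤ η * (-w.re - T) := by
    intro w hw η hη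
    by_contra! hcon
    obtain ⟨b₀, hb₀⟩ := hlow (η / 2) (by positivity)
    set b := max (max b₀ (-w.re)) (2 * m / η + 2 * T)
    have hbw : -b ≤ w.re := by
      have : -w.re ≤ b := (le_max_right _ _).trans (le_max_left _ _)
      linarith
    have hbb : b₀ ≤ b := (le_max_left _ _).trans (le_max_left _ _)
    have hbm : 2 * m / η + 2 * T ≤ b := le_max_right _ _
    set D : ℂ → ℝ := fun z => h z.re - V z - η * (-z.re - T) with hD
    have hDw : 0 < D w := by simp only [hD]; linarith
    obtain ⟨w₀, g1, g2, hmax⟩ := exists_isMax_strip (Q := D) (a := -b) (b := -T) (by linarith)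
      (by
        intro z hz
        have hlog : ContinuousAt (fun z : ℂ => Real.log (B - z.re)) z :=
          ContinuousAt.log (by fun_prop) (hpos z hz.2).ne'
        exact (((hlog.neg.sub continuousAt_const).sub (hV z hz.2).continuousAt).sub
          (by fun_prop)).continuousWithinAt)
      (by
        intro z
        simp only [hD]
        rw [hper z]
        simp)
    have hD0 : 0 < D w₀ := hDw.trans_le (hmax w hbw hw)
    have hright : w₀.re < -T := by
      refine lt_of_le_of_ne g2 fun he => ?_
      have := hmin w₀ he.ge he.le
      simp only [hD, he, hhT] at hD0
      linarith
    have hleft : -b < w₀.re := by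
      refine lt_of_le_of_ne g1 fun he => ?_
      have l1 := hb₀ w₀ (by linarith)
      have l2 := hhle w₀.re g2
      have l3 : 2 * m + 2 * T * η ≤ b * η := by
        have := mul_le_mul_of_nonneg_right hbm hη.le
        rwa [add_mul, div_mul_cancel₀ _ hη.ne'] at this
      simp only [hD] at hD0
      rw [← he] at l1 hD0 l2
      linarith
    have hp0 := hpos w₀ g2
    have hΔ0 := laplacian_le_of_isLocalMax_sub_re (V := -V) (w := w₀)
      (φ := fun x => -h x + η * (-x - T)) (φ' := fun x => -(B - x)⁻¹ - η)
      (a := -((B - w₀.re) ^ 2)⁻¹) (hV _ g2).neg ?_ ?_ ?_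
    · rw [laplacian_neg, Pi.neg_apply] at hΔ0
      have h3 : ((B - w₀.re)⁻¹) ^ 2 ≤ (√k * Real.exp (V w₀)) ^ 2 := by
        rw [mul_pow, Real.sq_sqrt hk.le, ← Real.exp_nat_mul, inv_pow]
        have := hΔ w₀ g2
        push_cast
        linarith
      have h4 := Real.log_le_log (by positivity) (le_of_sq_le_sq h3 (by positivity))
      rw [Real.log_inv, Real.log_mul hk'.ne' (Real.exp_pos _).ne', Real.log_exp] at h4
      have h5 : 0 ≤ η * (-w₀.re - T) := mul_nonneg hη.le (by linarith)
      simp only [hD, hh] at hD0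
      linarith
    · have e1 : ∀ᶠ x in 𝓝 w₀.re, 0 < B - x :=
        (Continuous.tendsto (by fun_prop : Continuous fun x : ℝ => B - x) _).eventually
          (lt_mem_nhds hp0)
      filter_upwards [e1] with x hx
      have d1 : HasDerivAt (fun x : ℝ => B - x) (-1) x := (hasDerivAt_id x).const_sub B
      have d2 : HasDerivAt (fun x : ℝ => -x - T) (-1) x := (hasDerivAt_neg x).sub_const T
      refine (((d1.log hx.ne').neg.sub_const _).neg.add (d2.const_mul η)).congr_deriv ?_
      field_simp
      ring
    · have d1 : HasDerivAt (fun x : ℝ => B - x) (-1) w₀.re := (hasDerivAt_id _).const_sub B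
      refine ((d1.inv hp0.ne').neg.sub_const η).congr_deriv ?_
      field_simp
    · have e1 : ∀ᶠ z : ℂ in 𝓝 w₀, z.re < -T :=
        continuous_re.continuousAt.eventually (gt_mem_nhds hright)
      have e2 : ∀ᶠ z : ℂ in 𝓝 w₀, -b < z.re :=
        continuous_re.continuousAt.eventually (lt_mem_nhds hleft)
      filter_upwards [e1, e2] with z hz1 hz2
      have := hmax z hz2.le hz1.le
      simp only [hD, Pi.neg_apply] at this ⊢
      linarith
  refine ⟨B, fun w hw => ⟨hpos w hw, ?_⟩⟩
  have hle : h w.re - V w ≤ 0 := by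
    refine ge_of_tendsto (x := 𝓝[>] (0 : ℝ)) (f := fun η => η * (-w.re - T)) ?_ ?_
    · have : Tendsto (fun η : ℝ => η * (-w.re - T)) (𝓝 0) (𝓝 (0 * (-w.re - T))) :=
        Continuous.tendsto (by fun_prop) 0
      rw [zero_mul] at this
      exact this.mono_left nhdsWithin_le_nhds
    · filter_upwards [self_mem_nhdsWithin] with η hη using key w hw η hη
  have hp := hpos w hw
  rw [← Real.log_nonneg_iff (by positivity), Real.log_mul (by positivity) hp.ne',
    Real.log_mul hk'.ne' (Real.exp_pos _).ne', Real.log_exp]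
  simp only [hh] at hle
  linarith

/-! ### Harnack inequality -/

lemma norm_fderiv_ofReal_le {V : ℂ → ℝ} {w : ℂ} (hV : DifferentiableAt ℝ V w) (h : ℂ) :
    ‖fderiv ℝ (fun z => (V z : ℂ)) w h‖ ≤ 2 * ‖dz (fun z => (V z : ℂ)) w‖ * ‖h‖ := by
  rw [fderiv_apply_eq_dz_dzbar, dzbar_ofReal hV, ← map_mul]
  refine (norm_add_le _ _).trans_eq ?_
  rw [norm_conj, norm_mul]
  ring

/-- Gradient estimate for a nonpositive function with bounded Laplacian: the first Fourier mode is
dominated by the mean, which is comparable to the value at the centre. -/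
lemma norm_dz_le_of_nonpos {V : ℂ → ℝ} {c : ℂ} {R C : ℝ} (hR : 1 < R)
    (hV : ∀ z ∈ ball c R, ContDiffAt ℝ 2 V z) (hneg : ∀ z ∈ ball c R, V z ≤ 0)
    (hΔ : ∀ z ∈ ball c R, |Laplacian.laplacian V z| ≤ C) :
    ‖dz (fun z => (V z : ℂ)) c‖ ≤ -V c + C := by
  set v : ℂ → ℂ := fun z => (V z : ℂ)
  have hv : ∀ z ∈ ball c R, ContDiffAt ℝ 2 v z := fun z hz => contDiffAt_ofReal_comp (hV z hz)
  have hG : ∀ z ∈ ball c R, ‖dzbar (dz v) z‖ ≤ C / 4 := fun z hz => by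
    rw [dzbar_dz_ofReal_eq_laplacian (hV z hz), norm_real, Real.norm_eq_abs, abs_div]
    have := hΔ z hz
    norm_num
    linarith
  have hmean := norm_circleMode_zero_sub_le hv hG one_pos hR
  have hgrad := norm_dz_le hv hG one_pos hR
  have h1 : |(1 : ℝ)| < R := by simpa
  have hvc : ContinuousOn v (ball c R) := fun z hz =>
    (hv z hz).continuousAt.continuousWithinAt
  have hVc : Continuous fun θ : ℝ => V (circleMap c 1 θ) :=
    ContinuousOn.comp_continuous (s := ball c R)
      (fun z hz => (hV z hz).continuousAt.continuousWithinAt)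
      (continuous_circleMap c 1) (circleMap_mem_ball h1)
  have e0 : circleMode v c 0 1 = ((∫ θ in (0 : ℝ)..2 * Real.pi, V (circleMap c 1 θ) : ℝ) : ℂ) := by
    rw [← intervalIntegral.integral_ofReal]
    simp [circleMode, v]
  have e1 : ‖circleMode v c 1 1‖ ≤ -∫ θ in (0 : ℝ)..2 * Real.pi, V (circleMap c 1 θ) := by
    rw [circleMode, ← intervalIntegral.integral_neg]
    refine intervalIntegral.norm_integral_le_of_norm_le Real.two_pi_pos.le
      (Eventually.of_forall fun θ _ => ?_) (hVc.neg.intervalIntegrable _ _)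
    rw [norm_mul, norm_cexp_neg_int_mul_I, mul_one, norm_real, Real.norm_eq_abs,
      abs_of_nonpos (hneg _ (circleMap_mem_ball h1 θ))]
  rw [e0, show (2 * Real.pi * v c : ℂ) = ((2 * Real.pi * V c : ℝ) : ℂ) by simp [v], ← ofReal_sub,
    norm_real, Real.norm_eq_abs] at hmean
  have hpi := Real.two_pi_pos
  have h2 := (abs_le.1 hmean).1
  have h3 : ‖circleMode v c 1 1‖ / (2 * Real.pi * 1) ≤ -V c + C / 4 := by
    rw [div_le_iff₀ (by positivity)]
    linarith
  have hC : 0 ≤ C := (abs_nonneg _).trans (hΔ c (mem_ball_self (by linarith)))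
  linarith

/-- Gronwall's inequality `f' ≤ 2f ⟹ f(b) ≤ f(a) e^{2(b-a)}`, without a sign condition on `f`. -/
lemma le_mul_exp_of_deriv_le {f f' : ℝ → ℝ} {a b : ℝ} (hf : ∀ x, HasDerivAt f (f' x) x)
    (hb : ∀ x, f' x ≤ 2 * f x) (hab : a ≤ b) : f b ≤ f a * Real.exp (2 * (b - a)) := by
  have hd : ∀ x, HasDerivAt (fun x => f x * Real.exp (-(2 * x)))
      (f' x * Real.exp (-(2 * x)) + f x * (Real.exp (-(2 * x)) * (-2))) x := fun x => by
    have h2 : HasDerivAt (fun x : ℝ => -(2 * x)) (-2) x :=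
      ((hasDerivAt_id x).const_mul (2 : ℝ)).neg.congr_deriv (by simp)
    exact (hf x).mul h2.exp
  have hanti : Antitone fun x => f x * Real.exp (-(2 * x)) :=
    antitone_of_deriv_nonpos (fun x => (hd x).differentiableAt) fun x => by
      rw [(hd x).deriv]
      have := mul_le_mul_of_nonneg_right (hb x) (Real.exp_pos (-(2 * x))).le
      linarith
  have h := mul_le_mul_of_nonneg_right (hanti hab) (Real.exp_pos (2 * b)).le
  simp only [mul_assoc, ← Real.exp_add] at h
  have e : -(2 * a) + 2 * b = 2 * (b - a) := by ring
  rw [e] at h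
  simpa using h

/-- Harnack inequality along the vertical lines in a half-plane. -/
lemma neg_add_le_exp_mul {V : ℂ → ℝ} {T C : ℝ}
    (hV : ∀ w : ℂ, w.re < -T → ContDiffAt ℝ 2 V w)
    (hper : Function.Periodic V (2 * Real.pi * I))
    (hneg : ∀ w : ℂ, w.re < -T → V w ≤ 0)
    (hΔ : ∀ w : ℂ, w.re < -T → |Laplacian.laplacian V w| ≤ C)
    {w w' : ℂ} (hw : w.re < -T - 2) (hre : w'.re = w.re) :
    -V w + C ≤ (-V w' + C) * Real.exp (4 * Real.pi) := by
  have hball : ∀ c : ℂ, c.re = w.re → ∀ z ∈ ball c 2, z.re < -T := fun c hc z hz => by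
    have := (abs_re_le_norm (z - c)).trans_lt (mem_ball_iff_norm.1 hz)
    rw [sub_re, hc] at this
    linarith [(abs_lt.1 this).2]
  -- replace `w'` by a translate by a period, slightly below `w`
  set n : ℤ := ⌊(w.im - w'.im) / (2 * Real.pi)⌋
  have hpi := Real.two_pi_pos
  have l1 := (le_div_iff₀ hpi).1 (Int.floor_le ((w.im - w'.im) / (2 * Real.pi)))
  have l2 := (div_lt_iff₀ hpi).1 (Int.lt_floor_add_one ((w.im - w'.im) / (2 * Real.pi)))
  set y := w'.im + n * (2 * Real.pi)
  set x := w.re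
  have hline : ∀ s : ℝ, ((x : ℂ) + s * I).re = x := fun s => by simp
  have hVw' : V w' = V (x + y * I) := by
    have h := (hper.int_mul n) w'
    rw [← h]
    congr 1
    apply Complex.ext <;> simp [hre, y]
  have hVw : V w = V (x + w.im * I) := by rw [re_add_im]
  have hd : ∀ s : ℝ, HasDerivAt (fun s : ℝ => -V (x + s * I) + C)
      (-fderiv ℝ V (x + s * I) I) s := fun s => by
    have hs := hV _ (hball _ (hline s) _ (mem_ball_self two_pos))
    exact ((hs.differentiableAt (by norm_num)).hasFDerivAt.comp_hasDerivAt s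
      (hasDerivAt_add_mul_ofReal x I s)).neg.add_const C
  have hb : ∀ s : ℝ, -fderiv ℝ V (x + s * I) I ≤ 2 * (-V (x + s * I) + C) := fun s => by
    have hs := hball _ (hline s)
    have hsd := (hV _ (hs _ (mem_ball_self two_pos))).differentiableAt (n := 2) (by norm_num)
    have h1 := norm_dz_le_of_nonpos one_lt_two (fun z hz => hV z (hs z hz))
      (fun z hz => hneg z (hs z hz)) (fun z hz => hΔ z (hs z hz))
    have h2 := norm_fderiv_ofReal_le hsd I
    have h3 : HasFDerivAt (fun z => (V z : ℂ)) (ofRealCLM.comp (fderiv ℝ V (x + s * I)))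
        (x + s * I) := ofRealCLM.hasFDerivAt.comp _ hsd.hasFDerivAt
    rw [h3.fderiv, norm_I, mul_one, ContinuousLinearMap.comp_apply, ofRealCLM_apply,
      norm_real, Real.norm_eq_abs] at h2
    linarith [neg_abs_le (fderiv ℝ V (x + s * I) I)]
  have := le_mul_exp_of_deriv_le hd hb (a := y) (b := w.im) (by simp only [y]; linarith)
  rw [← hVw, ← hVw'] at this
  refine this.trans (mul_le_mul_of_nonneg_left (Real.exp_le_exp.2 ?_) ?_)
  · simp only [y]
    linarith
  · have h1 := hball w' hre w' (mem_ball_self two_pos)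
    have := (abs_nonneg _).trans (hΔ w' h1)
    linarith [hneg w' h1]

/-! ### Asymptotics of periodic solutions of the curvature equation -/

/-- The filter `comap re atBot` describes `re w → -∞`, uniformly in the imaginary part. -/
lemma eventually_re_atBot {P : ℂ → Prop} :
    (∀ᶠ w in comap re atBot, P w) ↔ ∃ T : ℝ, ∀ w : ℂ, w.re ≤ -T → P w := by
  rw [(atBot_basis.comap re).eventually_iff]
  constructor
  · rintro ⟨a, -, h⟩
    exact ⟨-a, fun w hw => h (by simpa using hw)⟩
  · rintro ⟨T, h⟩
    exact ⟨-T, trivial, fun w hw => h w hw⟩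

lemma eventually_ball_re_atBot {P : ℂ → Prop} (r : ℝ) (h : ∀ᶠ w in comap re atBot, P w) :
    ∀ᶠ w in comap re atBot, ∀ z ∈ ball w r, P z := by
  rw [eventually_re_atBot] at h ⊢
  obtain ⟨T, hT⟩ := h
  refine ⟨T + r, fun w hw z hz => hT z ?_⟩
  have := (abs_re_le_norm (z - w)).trans_lt (mem_ball_iff_norm.1 hz)
  rw [sub_re] at this
  linarith [(abs_lt.1 this).2]

lemma tendsto_neg_re_atTop : Tendsto (fun w : ℂ => -w.re) (comap re atBot) atTop :=
  tendsto_neg_atBot_atTop.comp tendsto_comap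

lemma tendsto_neg_re_div (c : ℝ) :
    Tendsto (fun w : ℂ => -w.re / (-w.re + c)) (comap re atBot) (𝓝 1) := by
  have h1 : Tendsto (fun w : ℂ => 1 - c / (-w.re + c)) (comap re atBot) (𝓝 (1 - 0)) :=
    tendsto_const_nhds.sub (tendsto_const_nhds.div_atTop
      (tendsto_atTop_add_const_right _ c tendsto_neg_re_atTop))
  rw [sub_zero] at h1
  refine h1.congr' (eventually_re_atBot.2 ⟨1 - c, fun w hw => ?_⟩)
  have : -w.re + c ≠ 0 := by
    have : 0 < -w.re + c := by linarith
    exact this.ne'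
  field_simp
  ring

lemma abs_log_sub_log_le {a b δ : ℝ} (hδ : 0 < δ) (ha : δ ≤ a) (hb : δ ≤ b) :
    |Real.log a - Real.log b| ≤ |a - b| / δ := by
  wlog hab : b ≤ a generalizing a b
  · rw [abs_sub_comm, abs_sub_comm a b]
    exact this hb ha (not_le.1 hab).le
  have hb0 := hδ.trans_le hb
  have ha0 := hδ.trans_le ha
  rw [abs_of_nonneg (sub_nonneg.2 (Real.log_le_log hb0 hab)), abs_of_nonneg (sub_nonneg.2 hab),
    ← Real.log_div ha0.ne' hb0.ne']
  refine (Real.log_le_sub_one_of_pos (div_pos ha0 hb0)).trans ?_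
  rw [div_sub_one hb0.ne']
  exact div_le_div_of_nonneg_left (sub_nonneg.2 hab) hδ hb

lemma abs_exp_sub_exp_le {x y : ℝ} (hx : x ≤ 0) (hy : y ≤ 0) :
    |Real.exp x - Real.exp y| ≤ |x - y| := by
  wlog hxy : y ≤ x generalizing x y
  · rw [abs_sub_comm, abs_sub_comm x y]
    exact this hy hx (not_le.1 hxy).le
  rw [abs_of_nonneg (sub_nonneg.2 (Real.exp_le_exp.2 hxy)), abs_of_nonneg (sub_nonneg.2 hxy)]
  have h1 : Real.exp y = Real.exp x * Real.exp (y - x) := by rw [← Real.exp_add]; ring_nf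
  have h2 := Real.add_one_le_exp (y - x)
  have h3 := Real.exp_le_one_iff.2 hx
  have h4 := Real.exp_pos x
  rw [h1]
  nlinarith

/-- `V` is a `2πi`-periodic solution of the curvature equation `ΔV = K e^{2V}` near `re w = -∞`,
where `K` tends to `k₀ > 0`, and `V` does not decay linearly in `re w`: for every `η > 0`, each
vertical line far enough to the left contains a point where `V` is at least `η * re w`. -/
structure IsCuspPotential (V K : ℂ → ℝ) (k₀ : ℝ) : Prop where
  pos : 0 < k₀
  periodic : Function.Periodic V (2 * Real.pi * I)
  contDiffAt : ∀ᶠ w in comap re atBot, ContDiffAt ℝ 2 V w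
  laplacian_eq : ∀ᶠ w in comap re atBot, Laplacian.laplacian V w = K w * Real.exp (2 * V w)
  tendsto : Tendsto K (comap re atBot) (𝓝 k₀)
  slow : ∀ η > 0, ∀ᶠ t : ℝ in atTop, ∃ w : ℂ, w.re = -t ∧ -(η * t) ≤ V w

namespace IsCuspPotential

variable {V K : ℂ → ℝ} {k₀ : ℝ}

/-- Upper bound for `e^V` with any constant `k < k₀`. -/
lemma exists_upper (h : IsCuspPotential V K k₀) {k : ℝ} (hk : 0 < k) (hk₀ : k < k₀) :
    ∃ T, ∀ w : ℂ, w.re < -T → √k * Real.exp (V w) * (-w.re - T) ≤ 1 := by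
  obtain ⟨T, hT⟩ := eventually_re_atBot.1
    ((h.contDiffAt.and h.laplacian_eq).and (h.tendsto.eventually (lt_mem_nhds hk₀)))
  refine ⟨T, fun w hw => sqrt_mul_exp_mul_le_one hk (fun w hw => (hT w hw).1.1) h.periodic
    (fun w hw => ?_) hw⟩
  rw [(hT w hw).1.2]
  exact mul_le_mul_of_nonneg_right (hT w hw).2.le (Real.exp_pos _).le

lemma tendsto_exp (h : IsCuspPotential V K k₀) :
    Tendsto (fun w => Real.exp (V w)) (comap re atBot) (𝓝 0) := by
  have hk : 0 < k₀ / 2 := half_pos h.pos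
  obtain ⟨T, hT⟩ := h.exists_upper hk (half_lt_self h.pos)
  have hlim : Tendsto (fun w : ℂ => (√(k₀ / 2))⁻¹ * (-w.re - T)⁻¹) (comap re atBot) (𝓝 0) := by
    have := (tendsto_inv_atTop_zero.comp
      (tendsto_atTop_add_const_right _ (-T) tendsto_neg_re_atTop)).const_mul (√(k₀ / 2))⁻¹
    simpa [sub_eq_add_neg] using this
  refine squeeze_zero' (Eventually.of_forall fun w => (Real.exp_pos _).le) ?_ hlim
  refine eventually_re_atBot.2 ⟨T + 1, fun w hw => ?_⟩
  have h1 : 0 < -w.re - T := by linarith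
  have h2 := hT w (by linarith)
  have h3 : 0 < √(k₀ / 2) := Real.sqrt_pos.2 hk
  rw [← mul_inv, ← one_div, le_div_iff₀ (mul_pos h3 h1)]
  linarith

/-- By the Harnack inequality, slow decay at one point of each vertical line gives slow decay on
the whole line. -/
lemma exists_lower_linear (h : IsCuspPotential V K k₀) {η : ℝ} (hη : 0 < η) :
    ∃ b, ∀ w : ℂ, w.re ≤ -b → η * w.re ≤ V w := by
  have e1 := h.tendsto_exp.eventually (gt_mem_nhds one_pos)
  have e2 := h.tendsto.abs.eventually (gt_mem_nhds (lt_add_one |k₀|))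
  obtain ⟨T, hT⟩ := eventually_re_atBot.1 ((h.contDiffAt.and h.laplacian_eq).and (e1.and e2))
  have hneg : ∀ w : ℂ, w.re < -T → V w ≤ 0 := fun w hw => by
    have := (hT w hw.le).2.1
    rw [Real.exp_lt_one_iff] at this
    exact this.le
  set C := |k₀| + 1 with hC
  have hΔ : ∀ w : ℂ, w.re < -T → |Laplacian.laplacian V w| ≤ C := fun w hw => by
    rw [(hT w hw.le).1.2, abs_mul, Real.abs_exp]
    have h1 : Real.exp (2 * V w) ≤ 1 := Real.exp_le_one_iff.2 (by linarith [hneg w hw])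
    calc |K w| * Real.exp (2 * V w) ≤ C * 1 :=
          mul_le_mul (hT w hw.le).2.2.le h1 (Real.exp_pos _).le (by positivity)
      _ = C := mul_one C
  set A := Real.exp (4 * Real.pi)
  have hA : 0 < A := Real.exp_pos _
  obtain ⟨t₀, ht₀⟩ := eventually_atTop.1 (h.slow (η / (2 * A)) (by positivity))
  refine ⟨max (max t₀ (T + 3)) (2 * C * A / η), fun w hw => ?_⟩
  have m1 : t₀ ≤ -w.re := by
    linarith [(le_max_left t₀ (T + 3)).trans (le_max_left _ (2 * C * A / η))]
  have m2 : T + 3 ≤ -w.re := by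
    linarith [(le_max_right t₀ (T + 3)).trans (le_max_left _ (2 * C * A / η))]
  have m3 : 2 * C * A / η ≤ -w.re := by
    linarith [le_max_right (max t₀ (T + 3)) (2 * C * A / η)]
  rw [div_le_iff₀ hη] at m3
  obtain ⟨w', h1, h2⟩ := ht₀ _ m1
  rw [neg_neg] at h1
  have hH := neg_add_le_exp_mul (fun w hw => (hT w hw.le).1.1) h.periodic hneg hΔ
    (w := w) (w' := w') (by linarith) h1
  have h3 : (-V w' + C) * A ≤ (η / (2 * A) * -w.re + C) * A :=
    mul_le_mul_of_nonneg_right (by linarith) hA.le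
  have h4 : (η / (2 * A) * -w.re + C) * A = η / 2 * -w.re + C * A := by
    field_simp
  have hC0 : 0 ≤ C := by positivity
  linarith

/-- Lower bound for `e^V` with any constant `k > k₀`. -/
lemma exists_lower (h : IsCuspPotential V K k₀) {k : ℝ} (hk₀ : k₀ < k) :
    ∃ B T : ℝ, ∀ w : ℂ, w.re ≤ -T → 0 < B - w.re ∧ 1 ≤ √k * Real.exp (V w) * (B - w.re) := by
  obtain ⟨T, hT⟩ := eventually_re_atBot.1
    ((h.contDiffAt.and h.laplacian_eq).and (h.tendsto.eventually (gt_mem_nhds hk₀)))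
  obtain ⟨B, hB⟩ := exists_one_le_sqrt_mul_exp_mul (h.pos.trans hk₀)
    (fun w hw => (hT w hw).1.1) h.periodic (fun w hw => by
      rw [(hT w hw).1.2]
      exact mul_le_mul_of_nonneg_right (hT w hw).2.le (Real.exp_pos _).le)
    (fun η hη => h.exists_lower_linear hη)
  exact ⟨B, T, hB⟩

/-- The leading asymptotics `e^V ~ 1 / (√k₀ |re w|)`. -/
theorem tendsto_exp_mul (h : IsCuspPotential V K k₀) :
    Tendsto (fun w => Real.exp (V w) * -w.re) (comap re atBot) (𝓝 (1 / √k₀)) := by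
  have hcont : ContinuousAt (fun k : ℝ => 1 / √k) k₀ :=
    continuousAt_const.div Real.continuous_sqrt.continuousAt (Real.sqrt_pos.2 h.pos).ne'
  refine tendsto_order.2 ⟨fun a ha => ?_, fun a ha => ?_⟩
  · obtain ⟨k, hk, hak⟩ := ((hcont.eventually (lt_mem_nhds ha)).filter_mono
      nhdsWithin_le_nhds |>.and (self_mem_nhdsWithin (s := Set.Ioi k₀))).exists
    have hk' : 0 < √k := Real.sqrt_pos.2 (h.pos.trans hak)
    obtain ⟨B, T, hBT⟩ := h.exists_lower hak
    have hlim := (tendsto_neg_re_div B).const_mul (1 / √k)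
    rw [mul_one] at hlim
    filter_upwards [hlim.eventually (lt_mem_nhds hk), eventually_re_atBot.2 ⟨T, hBT⟩,
      eventually_re_atBot.2 ⟨0, fun w hw => hw⟩] with w h1 h2 h3
    refine h1.trans_le ?_
    have h4 : 0 < -w.re + B := by linarith [h2.1]
    rw [div_mul_div_comm, one_mul, div_le_iff₀ (mul_pos hk' h4)]
    have := mul_le_mul_of_nonneg_left h2.2 (by linarith : 0 ≤ -w.re)
    linarith
  · obtain ⟨k, ⟨hk, hk0⟩, hak⟩ := (((hcont.eventually (gt_mem_nhds ha)).and
      (lt_mem_nhds h.pos)).filter_mono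
      nhdsWithin_le_nhds |>.and (self_mem_nhdsWithin (s := Set.Iio k₀))).exists
    have hk' : 0 < √k := Real.sqrt_pos.2 hk0
    obtain ⟨T, hT⟩ := h.exists_upper hk0 hak
    have hlim := (tendsto_neg_re_div (-T)).const_mul (1 / √k)
    rw [mul_one] at hlim
    filter_upwards [hlim.eventually (gt_mem_nhds hk),
      eventually_re_atBot.2 ⟨T + 1, fun w hw => hT w (by linarith)⟩,
      eventually_re_atBot.2 ⟨0, fun w hw => hw⟩,
      eventually_re_atBot.2 ⟨T + 1, fun w hw => hw⟩] with w h1 h2 h3 h5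
    refine lt_of_le_of_lt ?_ h1
    have h4 : 0 < -w.re + -T := by linarith
    rw [div_mul_div_comm, one_mul, le_div_iff₀ (mul_pos hk' h4)]
    have := mul_le_mul_of_nonneg_left h2 (by linarith : 0 ≤ -w.re)
    linarith

lemma tendsto_dzbar_dz (h : IsCuspPotential V K k₀) :
    Tendsto (dzbar (dz fun z => (V z : ℂ))) (comap re atBot) (𝓝 0) := by
  have h1 : Tendsto (fun w => ((K w * (Real.exp (V w)) ^ 2 / 4 : ℝ) : ℂ)) (comap re atBot)
      (𝓝 ((k₀ * 0 ^ 2 / 4 : ℝ) : ℂ)) :=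
    (continuous_ofReal.tendsto _).comp ((h.tendsto.mul (h.tendsto_exp.pow 2)).div_const 4)
  rw [show ((k₀ * 0 ^ 2 / 4 : ℝ) : ℂ) = 0 by simp] at h1
  refine h1.congr' ?_
  filter_upwards [h.contDiffAt, h.laplacian_eq] with w hw1 hw2
  rw [dzbar_dz_ofReal_eq_laplacian hw1, hw2, ← Real.exp_nat_mul, Nat.cast_ofNat]

/-- The oscillation of `V` on discs of a fixed radius tends to zero. -/
lemma eventually_oscillation_le (h : IsCuspPotential V K k₀) {ε : ℝ} (hε : 0 < ε) :
    ∀ᶠ w in comap re atBot, ∀ z ∈ ball w 2, |V z - V w| ≤ ε := by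
  have hlog : Tendsto (fun w => Real.log (Real.exp (V w) * -w.re)) (comap re atBot)
      (𝓝 (Real.log (1 / √k₀))) :=
    (Real.continuousAt_log (one_div_pos.2 (Real.sqrt_pos.2 h.pos)).ne').tendsto.comp
      h.tendsto_exp_mul
  have e1 := eventually_ball_re_atBot 2
    (hlog.eventually (ball_mem_nhds _ (by positivity : 0 < ε / 4)))
  have e2 := eventually_ball_re_atBot 2
    (eventually_re_atBot.2 ⟨4 / ε + 4, fun w (hw : w.re ≤ -(4 / ε + 4)) => hw⟩)
  filter_upwards [e1, e2] with w h1 h2 z hz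
  have hw : w ∈ ball w 2 := mem_ball_self two_pos
  have hp : 0 < 4 / ε := by positivity
  have hV : ∀ x ∈ ball w 2, V x = Real.log (Real.exp (V x) * -x.re) - Real.log (-x.re) := by
    intro x hx
    have := h2 x hx
    rw [Real.log_mul (Real.exp_pos _).ne' (by linarith), Real.log_exp]
    ring
  have hz1 := h1 z hz
  have hw1 := h1 w hw
  have hl := abs_log_sub_log_le (a := -z.re) (b := -w.re) hp (by linarith [h2 z hz])
    (by linarith [h2 w hw])
  have hre : |-z.re - -w.re| ≤ 2 := by
    have := ((abs_re_le_norm (z - w)).trans_lt (mem_ball_iff_norm.1 hz)).le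
    rw [sub_re] at this
    rwa [← abs_neg, show -(-z.re - -w.re) = z.re - w.re by ring]
  have hl2 : |-z.re - -w.re| / (4 / ε) ≤ ε / 2 := by
    rw [div_le_iff₀ hp]
    have : ε / 2 * (4 / ε) = 2 := by field_simp; norm_num
    linarith
  rw [Real.dist_eq, abs_lt] at hz1 hw1
  rw [hV z hz, hV w hw]
  have h3 := abs_le.1 (hl.trans hl2)
  rw [abs_le]
  constructor <;> linarith [hz1.1, hz1.2, hw1.1, hw1.2, h3.1, h3.2]

/-- The gradient of `V` is controlled by its oscillation and its Laplacian on unit discs. -/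
theorem tendsto_dz (h : IsCuspPotential V K k₀) :
    Tendsto (dz fun z => (V z : ℂ)) (comap re atBot) (𝓝 0) := by
  rw [Metric.tendsto_nhds]
  intro ε hε
  have e1 := eventually_ball_re_atBot 2
    (h.tendsto_dzbar_dz.eventually (ball_mem_nhds _ (by positivity : 0 < ε / 4)))
  filter_upwards [e1, h.eventually_oscillation_le (by positivity : 0 < ε / 2),
    eventually_ball_re_atBot 2 h.contDiffAt] with w h1 h2 h3
  have hv : ∀ z ∈ ball w 2, ContDiffAt ℝ 2 (fun z => (V z : ℂ)) z := fun z hz =>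
    contDiffAt_ofReal_comp (h3 z hz)
  have hw : |(1 : ℝ)| < 2 := by norm_num
  have hgrad := norm_dz_le (G := ε / 4) hv
    (fun z hz => (mem_ball_zero_iff.1 (h1 z hz)).le) one_pos one_lt_two
  rw [← circleMode_sub_const one_ne_zero (fun z hz => (hv z hz).continuousAt.continuousWithinAt)
    (V w : ℂ) hw] at hgrad
  have hm : ‖circleMode (fun z => (V z : ℂ) - V w) w 1 1‖ ≤ 2 * Real.pi * (ε / 2) :=
    norm_circleMode_le fun θ => by
      rw [← ofReal_sub, norm_real]
      exact h2 _ (circleMap_mem_ball hw θ)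
  have hpi := Real.two_pi_pos
  have : ‖circleMode (fun z => (V z : ℂ) - V w) w 1 1‖ / (2 * Real.pi * 1) ≤ ε / 2 := by
    rw [div_le_iff₀ (by positivity)]
    linarith
  rw [dist_zero_right]
  linarith

/-- With a Hölder continuous `K`, the second derivatives tend to zero as well. -/
theorem tendsto_dz_dz (h : IsCuspPotential V K k₀) {C ν : ℝ} (hν : 0 < ν) (hν1 : ν ≤ 1)
    (hK : ∀ᶠ w in comap re atBot, ∀ z ∈ ball w 1, |K z - K w| ≤ C * ‖z - w‖ ^ ν) :
    Tendsto (dz (dz fun z => (V z : ℂ))) (comap re atBot) (𝓝 0) := by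
  set v : ℂ → ℂ := fun z => (V z : ℂ)
  -- Below, `|∂V| ≤ ε`, and `∂̄∂V` has Hölder constant `(|C|/4 + |k₀| + 1) ε` at `w`; the interior
  -- estimate with `r = 1/2` then bounds `∂∂V(w)` by `D ε`.
  set D := 2 + 2 * (|C| / 4 + |k₀| + 1) / ν with hD
  have hD0 : 0 < D := by positivity
  rw [Metric.tendsto_nhds]
  intro ε' hε'
  obtain ⟨ε, hε, hεD⟩ : ∃ ε, 0 < ε ∧ D * ε < ε' :=
    ⟨ε' / (2 * D), by positivity, by
      rw [show D * (ε' / (2 * D)) = ε' / 2 by field_simp]; exact half_lt_self hε'⟩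
  have e1 := h.tendsto_exp.eventually (gt_mem_nhds (lt_min one_pos hε))
  have e2 := h.tendsto.abs.eventually (gt_mem_nhds (lt_add_one |k₀|))
  have e3 := h.tendsto_dz.eventually (ball_mem_nhds _ hε)
  filter_upwards [hK, eventually_ball_re_atBot 1
    ((h.contDiffAt.and h.laplacian_eq).and (e1.and (e2.and e3)))] with w hKw hall
  have hc : ∀ z ∈ ball w 1, ContDiffAt ℝ 2 V z := fun z hz => (hall z hz).1.1
  have hv : ∀ z ∈ ball w 1, ContDiffAt ℝ 2 v z := fun z hz => contDiffAt_ofReal_comp (hc z hz)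
  have hdv : ∀ z ∈ ball w 1, ‖dz v z‖ ≤ ε := fun z hz =>
    (mem_ball_zero_iff.1 (hall z hz).2.2.2).le
  have hexp : ∀ z ∈ ball w 1, Real.exp (V z) ≤ ε := fun z hz =>
    ((hall z hz).2.1.trans_le (min_le_right _ _)).le
  have hneg : ∀ z ∈ ball w 1, V z ≤ 0 := fun z hz => by
    have := (hall z hz).2.1.trans_le (min_le_left _ _)
    rw [Real.exp_lt_one_iff] at this
    exact this.le
  have hexp2 : ∀ z ∈ ball w 1, Real.exp (2 * V z) ≤ ε := fun z hz =>
    (Real.exp_le_exp.2 (by linarith [hneg z hz])).trans (hexp z hz)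
  have hw : w ∈ ball w 1 := mem_ball_self one_pos
  have hlip : ∀ z ∈ ball w 1, |V z - V w| ≤ 2 * ε * ‖z - w‖ := fun z hz => by
    have := (convex_ball w 1).norm_image_sub_le_of_norm_fderiv_le (𝕜 := ℝ) (f := v) (C := 2 * ε)
      (fun x hx => (hv x hx).differentiableAt (by norm_num)) (fun x hx => by
        refine ContinuousLinearMap.opNorm_le_bound _ (by positivity) fun y => ?_
        refine (norm_fderiv_ofReal_le ((hc x hx).differentiableAt (by norm_num)) y).trans ?_
        have := hdv x hx
        gcongr) hw hz
    rwa [← ofReal_sub, norm_real] at this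
  have hhol : ∀ z ∈ ball w 1, ‖dzbar (dz v) z - dzbar (dz v) w‖ ≤
      (|C| / 4 + |k₀| + 1) * ε * ‖z - w‖ ^ ν := fun z hz => by
    rw [dzbar_dz_ofReal_eq_laplacian (hc z hz), dzbar_dz_ofReal_eq_laplacian (hc w hw),
      ← ofReal_sub, norm_real, Real.norm_eq_abs, (hall z hz).1.2, (hall w hw).1.2]
    have hpow : ‖z - w‖ ≤ ‖z - w‖ ^ ν :=
      Real.self_le_rpow_of_le_one (norm_nonneg _) (mem_ball_iff_norm.1 hz).le hν1
    have h1 : |K z - K w| * Real.exp (2 * V z) ≤ |C| * ‖z - w‖ ^ ν * ε := by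
      refine mul_le_mul ((hKw z hz).trans ?_) (hexp2 z hz) (Real.exp_pos _).le (by positivity)
      exact mul_le_mul_of_nonneg_right (le_abs_self C) (by positivity)
    have h2 : |Real.exp (2 * V z) - Real.exp (2 * V w)| ≤ 4 * ε * ‖z - w‖ ^ ν := by
      refine (abs_exp_sub_exp_le (by linarith [hneg z hz]) (by linarith [hneg w hw])).trans ?_
      rw [← mul_sub, abs_mul, abs_two]
      have := mul_le_mul_of_nonneg_left hpow hε.le
      linarith [hlip z hz]
    have h3 : |K w| * |Real.exp (2 * V z) - Real.exp (2 * V w)| ≤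
        (|k₀| + 1) * (4 * ε * ‖z - w‖ ^ ν) :=
      mul_le_mul (hall w hw).2.2.1.le h2 (abs_nonneg _) (by positivity)
    have h4 : K z * Real.exp (2 * V z) / 4 - K w * Real.exp (2 * V w) / 4 =
      ((K z - K w) * Real.exp (2 * V z) + K w * (Real.exp (2 * V z) - Real.exp (2 * V w))) / 4 := by
      ring
    rw [h4, abs_div, abs_of_pos (four_pos : (0 : ℝ) < 4)]
    have h5 := abs_add_le ((K z - K w) * Real.exp (2 * V z))
      (K w * (Real.exp (2 * V z) - Real.exp (2 * V w)))
    rw [abs_mul, abs_mul, Real.abs_exp] at h5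
    linarith
  have hfin := norm_dz_le_of_dzbar_holder (r := 1 / 2) hν
    (fun z hz => contDiffAt_dz (hv z hz)) hdv hhol (by norm_num) (by norm_num)
  have hhalf : (1 / 2 : ℝ) ^ ν ≤ 1 := Real.rpow_le_one (by norm_num) (by norm_num) hν.le
  have h6 : 2 * ((|C| / 4 + |k₀| + 1) * ε) * (1 / 2 : ℝ) ^ ν / ν ≤
      2 * ((|C| / 4 + |k₀| + 1) * ε) * 1 / ν := by gcongr
  have h7 : ε / (1 / 2) + 2 * ((|C| / 4 + |k₀| + 1) * ε) * 1 / ν = D * ε := by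
    rw [hD]; field_simp
  rw [dist_zero_right]
  linarith

end IsCuspPotential

/-! ### Logarithmic coordinates at the singularity -/

/-- The logarithm of the density of the pulled back metric in the coordinate `w` with
`z = p + e^w`. -/
noncomputable def logDensity (lam : ℂ → ℝ) (p w : ℂ) : ℝ :=
  Real.log (lam (p + cexp w)) + w.re

lemma hasDerivAt_add_cexp (p w : ℂ) : HasDerivAt (fun w => p + cexp w) (cexp w) w :=
  (hasDerivAt_exp w).const_add p

lemma dz_comp_add_cexp {f : ℂ → ℂ} {p w : ℂ} (hf : DifferentiableAt ℝ f (p + cexp w)) :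
    dz (fun x => f (p + cexp x)) w = dz f (p + cexp w) * cexp w :=
  dz_comp_holomorphic (ψ := fun w => p + cexp w) hf (hasDerivAt_add_cexp p w)

lemma dzbar_comp_add_cexp {f : ℂ → ℂ} {p w : ℂ} (hf : DifferentiableAt ℝ f (p + cexp w)) :
    dzbar (fun x => f (p + cexp x)) w = dzbar f (p + cexp w) * conj (cexp w) :=
  dzbar_comp_holomorphic (ψ := fun w => p + cexp w) hf (hasDerivAt_add_cexp p w)

lemma tendsto_add_cexp (p : ℂ) :
    Tendsto (fun w => p + cexp w) (comap re atBot) (𝓝[≠] p) := by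
  refine tendsto_nhdsWithin_iff.2 ⟨?_, Eventually.of_forall fun w => by simp⟩
  have : Tendsto cexp (comap re atBot) (𝓝 0) := by
    rw [tendsto_zero_iff_norm_tendsto_zero]
    simp only [norm_exp]
    exact Real.tendsto_exp_atBot.comp tendsto_comap
  simpa using this.const_add p

lemma tendsto_log_sub (p : ℂ) :
    Tendsto (fun z => log (z - p)) (𝓝[≠] p) (comap re atBot) := by
  rw [tendsto_comap_iff]
  have h1 : Tendsto (fun z : ℂ => ‖z - p‖) (𝓝[≠] p) (𝓝[>] 0) := by
    refine tendsto_nhdsWithin_iff.2 ⟨?_, ?_⟩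
    · have : Tendsto (fun z : ℂ => ‖z - p‖) (𝓝 p) (𝓝 ‖p - p‖) :=
        Continuous.tendsto (by fun_prop) p
      simp only [sub_self, norm_zero] at this
      exact this.mono_left nhdsWithin_le_nhds
    · filter_upwards [self_mem_nhdsWithin] with z hz
      exact norm_pos_iff.2 (sub_ne_zero.2 hz)
  refine (Real.tendsto_log_nhdsGT_zero.comp h1).congr fun z => ?_
  simp [log_re]

/-- Limits at `p` may be computed in logarithmic coordinates. -/
lemma tendsto_punctured_of_comp_add_cexp {G : ℂ → ℂ} {p a : ℂ}
    (h : Tendsto (fun w => G (p + cexp w)) (comap re atBot) (𝓝 a)) :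
    Tendsto G (𝓝[≠] p) (𝓝 a) := by
  refine (h.comp (tendsto_log_sub p)).congr' ?_
  filter_upwards [self_mem_nhdsWithin] with z hz
  simp only [Function.comp_apply]
  rw [exp_log (sub_ne_zero.2 hz), add_sub_cancel]

lemma eventually_nhds_re_atBot {P : ℂ → Prop} (h : ∀ᶠ w in comap re atBot, P w) :
    ∀ᶠ w in comap re atBot, ∀ᶠ z in 𝓝 w, P z :=
  (eventually_ball_re_atBot 1 h).mono fun _ hw =>
    (ball_mem_nhds _ one_pos : _ ∈ 𝓝 _) |> fun hb => mem_of_superset hb hw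

lemma periodic_logDensity (lam : ℂ → ℝ) (p : ℂ) :
    Function.Periodic (logDensity lam p) (2 * Real.pi * I) := fun w => by
  rw [logDensity, logDensity, exp_periodic w]
  simp

lemma contDiffAt_logDensity {lam : ℂ → ℝ} {p w : ℂ} (hpos : lam (p + cexp w) ≠ 0)
    (hlam : ContDiffAt ℝ 2 lam (p + cexp w)) : ContDiffAt ℝ 2 (logDensity lam p) w := by
  have hψ : ContDiffAt ℝ 2 (fun w => p + cexp w) w :=
    contDiffAt_const.add contDiff_exp.contDiffAt
  exact ((hlam.comp w hψ).log hpos).add reCLM.contDiff.contDiffAt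

/-- Conformal change of coordinates for the Laplacian of the logarithmic density. -/
lemma laplacian_logDensity {lam : ℂ → ℝ} {p w : ℂ}
    (hlam : ∀ᶠ z in 𝓝 w, lam (p + cexp z) ≠ 0 ∧ ContDiffAt ℝ 2 lam (p + cexp z)) :
    Laplacian.laplacian (logDensity lam p) w =
      Real.exp w.re ^ 2 * Laplacian.laplacian (fun z => Real.log (lam z)) (p + cexp w) := by
  set u : ℂ → ℝ := fun z => Real.log (lam z)
  have hu : ∀ᶠ z in 𝓝 w, ContDiffAt ℝ 2 u (p + cexp z) :=
    hlam.mono fun z hz => hz.2.log hz.1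
  set uc : ℂ → ℂ := fun z => (u z : ℂ)
  have hre : ∀ z : ℂ, DifferentiableAt ℝ (fun x : ℂ => (x.re : ℂ)) z := fun z =>
    (ofRealCLM.comp reCLM).differentiableAt
  have hψd : ∀ z, DifferentiableAt ℝ (fun w => p + cexp w) z := fun z =>
    (hasDerivAt_add_cexp p z).differentiableAt.restrictScalars ℝ
  have h1 : (dz fun z => (logDensity lam p z : ℂ)) =ᶠ[𝓝 w]
      fun z => dz uc (p + cexp z) * cexp z + 1 / 2 := by
    filter_upwards [hu] with z hz
    have hd : DifferentiableAt ℝ uc (p + cexp z) :=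
      (contDiffAt_ofReal_comp hz).differentiableAt (by norm_num)
    have e : (fun z => (logDensity lam p z : ℂ)) = fun z => uc (p + cexp z) + (z.re : ℂ) := by
      ext z
      simp [logDensity, uc, u]
    have hcd : DifferentiableAt ℝ (fun z => uc (p + cexp z)) z := hd.comp z (hψd z)
    rw [e, dz_add hcd (hre z), dz_comp_add_cexp hd,
      dz_re]
  have huw := hu.self_of_nhds
  have hdu : DifferentiableAt ℝ (dz uc) (p + cexp w) :=
    (contDiffAt_dz (contDiffAt_ofReal_comp huw)).differentiableAt (by norm_num)
  have hexp : DifferentiableAt ℝ cexp w := (hasDerivAt_exp w).differentiableAt.restrictScalars ℝ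
  have h2 := dzbar_dz_ofReal_eq_laplacian
    (contDiffAt_logDensity hlam.self_of_nhds.1 hlam.self_of_nhds.2)
  have hcomp : DifferentiableAt ℝ (fun z => dz uc (p + cexp z)) w :=
    DifferentiableAt.comp (g := dz uc) w hdu (hψd w)
  have hmul : DifferentiableAt ℝ (fun z => dz uc (p + cexp z) * cexp z) w := hcomp.mul hexp
  rw [dzbar_congr h1, dzbar_add hmul (differentiableAt_const _),
    dzbar_mul hcomp hexp, dzbar_comp_add_cexp hdu,
    dzbar_of_hasDerivAt (hasDerivAt_exp w), dzbar_of_hasDerivAt (hasDerivAt_const w (1 / 2 : ℂ)),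
    dzbar_dz_ofReal_eq_laplacian huw, mul_zero, add_zero, add_zero, mul_assoc, conj_mul',
    norm_exp] at h2
  have h3 : Laplacian.laplacian u (p + cexp w) / 4 * Real.exp w.re ^ 2 =
      Laplacian.laplacian (logDensity lam p) w / 4 := by exact_mod_cast h2
  linarith

lemma exp_logDensity {lam : ℂ → ℝ} {p w : ℂ} (hpos : 0 < lam (p + cexp w)) :
    Real.exp (logDensity lam p w) = lam (p + cexp w) * Real.exp w.re := by
  rw [logDensity, Real.exp_add, Real.exp_log hpos]

lemma norm_cexp_sub_cexp_le {w z : ℂ} (h : ∀ x ∈ ball w 1, x.re ≤ 0) (hz : z ∈ ball w 1) :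
    ‖cexp z - cexp w‖ ≤ ‖z - w‖ := by
  have := (convex_ball w 1).norm_image_sub_le_of_norm_hasDerivWithin_le (f := cexp) (f' := cexp)
    (C := 1) (fun x _ => (hasDerivAt_exp x).hasDerivWithinAt)
    (fun x hx => by rw [norm_exp]; exact Real.exp_le_one_iff.2 (h x hx))
    (mem_ball_self one_pos) hz
  simpa using this

/-- Order one of `log λ` at `p` means that the logarithmic density decays sublinearly at some
points of every vertical line. -/
lemma exists_le_logDensity_of_hasOrderAt {Ω : Set ℂ} {lam : ℂ → ℝ} {p : ℂ} (hΩ : Ω ∈ 𝓝[≠] p)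
    (hlam : IsRegular lam Ω) (horder : HasOrderAt (fun z => Real.log (lam z)) p 1)
    {η : ℝ} (hη : 0 < η) :
    ∀ᶠ t : ℝ in atTop, ∃ w : ℂ, w.re = -t ∧ -(η * t) ≤ logDensity lam p w := by
  have hr : Tendsto (fun t : ℝ => Real.exp (-t)) atTop (𝓝[>] 0) :=
    Real.tendsto_exp_atBot_nhdsGT.comp tendsto_neg_atTop_atBot
  have h1 := hr.eventually (horder.eventually (lt_mem_nhds (by linarith : 1 - η < 1)))
  obtain ⟨δ, hδ, hball⟩ := Metric.mem_nhdsWithin_iff.1 hΩ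
  have h2 := hr.eventually (Ioo_mem_nhdsGT hδ)
  filter_upwards [h1, h2, eventually_gt_atTop 0] with t ht ht2 ht0
  have hsub : sphere p (Real.exp (-t)) ⊆ Ω := fun z hz => by
    refine hball ⟨?_, ?_⟩
    · rw [mem_ball, mem_sphere.1 hz]
      exact ht2.2
    · rintro rfl
      rw [mem_sphere, dist_self] at hz
      exact (Real.exp_pos _).ne hz
  have hcont : ContinuousOn (fun z => Real.log (lam z)) (sphere p (Real.exp (-t))) :=
    (hlam.contDiffOn.continuousOn.mono hsub).log fun z hz => (hlam.pos z (hsub hz)).ne'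
  obtain ⟨z, hz, hsup⟩ := (isCompact_sphere p _).exists_sSup_image_eq
    (NormedSpace.sphere_nonempty.2 (Real.exp_pos (-t)).le) hcont
  rw [circleSup, hsup, one_div, Real.log_inv, Real.log_exp, neg_neg, lt_div_iff₀ ht0] at ht
  have hzp : z - p ≠ 0 := by
    rw [← norm_pos_iff, mem_sphere_iff_norm.1 hz]
    exact Real.exp_pos _
  have hre : (log (z - p)).re = -t := by
    rw [log_re, mem_sphere_iff_norm.1 hz, Real.log_exp]
  refine ⟨log (z - p), hre, ?_⟩
  rw [logDensity, exp_log hzp, add_sub_cancel, hre]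
  linarith

/-- The curvature equation, the curvature bound and the order condition in logarithmic
coordinates. -/
theorem isCuspPotential_logDensity {Ω : Set ℂ} {p : ℂ} {lam κ : ℂ → ℝ} {ν : ℝ≥0}
    (hΩ_open : IsOpen Ω) (hp_isol : Ω ∈ 𝓝[≠] p) (hlam : IsRegular lam Ω)
    (hκ_curv : ∀ z ∈ Ω, κ z = curvature lam z) (hν_pos : 0 < ν)
    (hκ_holder : LocallyHolderOn ν κ (Ω ∪ {p})) (hκ_neg : κ p < 0)
    (horder : HasOrderAt (fun z => Real.log (lam z)) p 1) :
    IsCuspPotential (logDensity lam p) (fun w => -κ (p + cexp w)) (-κ p) := by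
  have hev : ∀ᶠ w in comap re atBot, p + cexp w ∈ Ω := (tendsto_add_cexp p).eventually hp_isol
  have hcd : ∀ z ∈ Ω, lam z ≠ 0 ∧ ContDiffAt ℝ 2 lam z := fun z hz =>
    ⟨(hlam.pos z hz).ne', hlam.contDiffOn.contDiffAt (hΩ_open.mem_nhds hz)⟩
  refine ⟨by linarith, periodic_logDensity lam p, ?_, ?_, ?_, fun η hη =>
    exists_le_logDensity_of_hasOrderAt hp_isol hlam horder hη⟩
  · filter_upwards [hev] with w hw
    exact contDiffAt_logDensity (hcd _ hw).1 (hcd _ hw).2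
  · filter_upwards [eventually_nhds_re_atBot hev] with w hw
    have hw0 := hw.self_of_nhds
    have hpos := hlam.pos _ hw0
    rw [laplacian_logDensity (hw.mono fun z hz => hcd _ hz), hκ_curv _ hw0, curvature,
      two_mul, Real.exp_add, exp_logDensity hpos]
    field_simp
  · obtain ⟨C, U, hU, hC⟩ := hκ_holder p (by simp)
    have hc : ContinuousWithinAt κ (U ∩ (Ω ∪ {p})) p :=
      hC.continuousOn hν_pos p ⟨mem_of_mem_nhds hU, by simp⟩
    refine (hc.tendsto.comp (tendsto_nhdsWithin_iff.2
      ⟨(tendsto_add_cexp p).mono_right nhdsWithin_le_nhds, ?_⟩)).neg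
    filter_upwards [hev, (tendsto_add_cexp p).eventually (mem_nhdsWithin_of_mem_nhds hU)]
      with w h1 h2 using ⟨h2, .inl h1⟩

/-- Far to the left `exp` contracts, so the Hölder condition at `p` survives the change of
coordinates. -/
lemma exists_holder_comp_add_cexp {Ω : Set ℂ} {p : ℂ} {κ : ℂ → ℝ} {ν : ℝ≥0}
    (hp_isol : Ω ∈ 𝓝[≠] p) (hκ_holder : LocallyHolderOn ν κ (Ω ∪ {p})) :
    ∃ C : ℝ, ∀ᶠ w in comap re atBot, ∀ z ∈ ball w 1,
      |-κ (p + cexp z) - -κ (p + cexp w)| ≤ C * ‖z - w‖ ^ (ν : ℝ) := by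
  obtain ⟨C, U, hU, hC⟩ := hκ_holder p (by simp)
  have hmem := ((tendsto_add_cexp p).eventually hp_isol).and
    ((tendsto_add_cexp p).eventually (mem_nhdsWithin_of_mem_nhds hU))
  refine ⟨C, ?_⟩
  filter_upwards [eventually_ball_re_atBot 1 hmem,
    eventually_ball_re_atBot 1 (eventually_re_atBot.2 ⟨0, fun w hw => hw⟩)] with w h1 h2 z hz
  have hw := mem_ball_self (x := w) one_pos
  have h3 := hC.dist_le ⟨(h1 z hz).2, .inl (h1 z hz).1⟩ ⟨(h1 w hw).2, .inl (h1 w hw).1⟩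
  rw [Real.dist_eq, dist_add_left, dist_eq] at h3
  rw [neg_sub_neg, abs_sub_comm]
  refine h3.trans (mul_le_mul_of_nonneg_left (Real.rpow_le_rpow (norm_nonneg _) ?_ ν.2) C.2)
  exact norm_cexp_sub_cexp_le (fun x hx => by simpa using h2 x hx) hz

/-! ### Derivatives of the density in logarithmic coordinates -/

section Derivatives

variable {Ω : Set ℂ} {p w : ℂ} {lam : ℂ → ℝ}

/-- First derivative of `λ(p + e^w) = e^{V(w) - re w}`. -/
lemma dz_density_mul_cexp (hpos : ∀ᶠ z in 𝓝 w, 0 < lam (p + cexp z))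
    (hlam : ContDiffAt ℝ 2 lam (p + cexp w)) :
    dz (fun z => (lam z : ℂ)) (p + cexp w) * cexp w =
      cexp (logDensity lam p w - w.re) *
        (dz (fun z => (logDensity lam p z : ℂ)) w - 1 / 2) := by
  have hV := (contDiffAt_ofReal_comp
    (contDiffAt_logDensity hpos.self_of_nhds.ne' hlam)).differentiableAt (n := 2) (by norm_num)
  have hre := differentiableAt_neg_re w
  rw [← dz_comp_add_cexp ((contDiffAt_ofReal_comp hlam).differentiableAt (by norm_num))]
  have h1 : (fun z => (lam (p + cexp z) : ℂ)) =ᶠ[𝓝 w]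
      fun z => cexp (logDensity lam p z + ((-z.re : ℝ) : ℂ)) := by
    filter_upwards [hpos] with z hz
    rw [← ofReal_add, ← ofReal_exp, Real.exp_add, exp_logDensity hz, mul_assoc, ← Real.exp_add]
    simp
  rw [dz_congr h1, dz_cexp (hV.fun_add hre), dz_add hV hre, dz_neg_re]
  push_cast
  ring_nf

/-- Second derivatives of `λ(p + e^w) = e^{V(w) - re w}`, obtained by differentiating the identity
`dz_density_mul_cexp`. -/
lemma second_derivatives_density
    (hlam : ∀ᶠ z in 𝓝 w, 0 < lam (p + cexp z) ∧ ContDiffAt ℝ 2 lam (p + cexp z)) :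
    dz (dz fun z => (lam z : ℂ)) (p + cexp w) * cexp w ^ 2 =
      cexp (logDensity lam p w - w.re) *
        ((dz (fun z => (logDensity lam p z : ℂ)) w - 1 / 2) ^ 2 +
          dz (dz fun z => (logDensity lam p z : ℂ)) w -
          (dz (fun z => (logDensity lam p z : ℂ)) w - 1 / 2)) ∧
    dzbar (dz fun z => (lam z : ℂ)) (p + cexp w) * (conj (cexp w) * cexp w) =
      cexp (logDensity lam p w - w.re) *
        (conj (dz (fun z => (logDensity lam p z : ℂ)) w - 1 / 2) *
          (dz (fun z => (logDensity lam p z : ℂ)) w - 1 / 2) +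
          dzbar (dz fun z => (logDensity lam p z : ℂ)) w) := by
  obtain ⟨hpos0, hlam0⟩ := hlam.self_of_nhds
  set V : ℂ → ℂ := fun z => (logDensity lam p z : ℂ)
  have hV2 : ContDiffAt ℝ 2 V w := contDiffAt_ofReal_comp (contDiffAt_logDensity hpos0.ne' hlam0)
  have hV := hV2.differentiableAt (n := 2) (by norm_num)
  have hdV := (contDiffAt_dz hV2).differentiableAt (by norm_num)
  have hre := differentiableAt_neg_re w
  have hdl : DifferentiableAt ℝ (dz fun z => (lam z : ℂ)) (p + cexp w) :=
    (contDiffAt_dz (contDiffAt_ofReal_comp hlam0)).differentiableAt (by norm_num)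
  have hcomp : DifferentiableAt ℝ (fun z => dz (fun z => (lam z : ℂ)) (p + cexp z)) w :=
    DifferentiableAt.comp (g := dz fun z => (lam z : ℂ)) w hdl
      ((hasDerivAt_add_cexp p w).differentiableAt.restrictScalars ℝ)
  have hexp : DifferentiableAt ℝ cexp w := (hasDerivAt_exp w).differentiableAt.restrictScalars ℝ
  have hq : DifferentiableAt ℝ (fun z => V z + ((-z.re : ℝ) : ℂ)) w := hV.add hre
  have hdq : DifferentiableAt ℝ (fun z => dz V z - 1 / 2) w := hdV.sub_const _
  have h0 := dz_density_mul_cexp (hlam.mono fun z hz => hz.1) hlam0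
  have key : (fun z => dz (fun z => (lam z : ℂ)) (p + cexp z) * cexp z) =ᶠ[𝓝 w]
      fun z => cexp (V z + ((-z.re : ℝ) : ℂ)) * (dz V z - 1 / 2) := by
    filter_upwards [eventually_eventually_nhds.2 hlam] with z hz
    have := dz_density_mul_cexp (hz.mono fun z hz => hz.1) hz.self_of_nhds.2
    rw [this]
    push_cast
    rw [sub_eq_add_neg]
  have e : V w + ((-w.re : ℝ) : ℂ) = V w - w.re := by push_cast; ring
  constructor
  · have h1 := dz_congr key
    rw [dz_mul hcomp hexp, dz_mul hq.cexp hdq, dz_cexp hq, dz_add hV hre, dz_neg_re,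
      dz_sub_const,
      dz_of_hasDerivAt (hasDerivAt_exp w), dz_comp_add_cexp hdl,
      e] at h1
    linear_combination h1 - h0
  · have h1 := dzbar_congr key
    rw [dzbar_mul hcomp hexp, dzbar_mul hq.cexp hdq, dzbar_cexp hq, dzbar_add hV hre,
      dzbar_neg_re, dzbar_sub_const,
      dzbar_of_hasDerivAt (hasDerivAt_exp w), dzbar_comp_add_cexp hdl,
      dzbar_ofReal ((contDiffAt_logDensity hpos0.ne' hlam0).differentiableAt (by norm_num)),
      e] at h1
    have hc : conj (dz V w - 1 / 2) = conj (dz V w) - 1 / 2 := by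
      simp [map_ofNat]
    rw [hc]
    linear_combination h1

end Derivatives

/-- The limits of the derivatives of a density whose logarithmic density is a cusp potential. -/
theorem tendsto_derivatives_density {lam K : ℂ → ℝ} {p : ℂ} {k₀ C ν : ℝ}
    (h : IsCuspPotential (logDensity lam p) K k₀) (hν_pos : 0 < ν) (hν_le : ν ≤ 1)
    (hC : ∀ᶠ w in comap re atBot, ∀ z ∈ ball w 1, |K z - K w| ≤ C * ‖z - w‖ ^ ν)
    (hloc : ∀ᶠ w in comap re atBot, ∀ᶠ z in 𝓝 w,
      0 < lam (p + cexp z) ∧ ContDiffAt ℝ 2 lam (p + cexp z)) :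
    Tendsto (fun z : ℂ => (z - p) * ((‖z - p‖ * Real.log (1 / ‖z - p‖) : ℝ) : ℂ) *
        dz (fun w => (lam w : ℂ)) z)
      (𝓝[≠] p) (𝓝 ((-(1 / (2 * √k₀)) : ℝ) : ℂ)) ∧
    Tendsto (fun z : ℂ => (z - p) ^ 2 * ((‖z - p‖ * Real.log (1 / ‖z - p‖) : ℝ) : ℂ) *
        dz (dz (fun w => (lam w : ℂ))) z)
      (𝓝[≠] p) (𝓝 ((3 / (4 * √k₀) : ℝ) : ℂ)) ∧
    Tendsto (fun z : ℂ => ((‖z - p‖ ^ 3 * Real.log (1 / ‖z - p‖) : ℝ) : ℂ) *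
        dzbar (dz (fun w => (lam w : ℂ))) z)
      (𝓝[≠] p) (𝓝 ((1 / (4 * √k₀) : ℝ) : ℂ)) := by
  set V := logDensity lam p
  have hE : Tendsto (fun w => ((Real.exp (V w) * -w.re : ℝ) : ℂ)) (comap re atBot)
      (𝓝 ((1 / √k₀ : ℝ) : ℂ)) := (continuous_ofReal.tendsto _).comp h.tendsto_exp_mul
  have ha := h.tendsto_dz.sub_const (1 / 2)
  have hb := h.tendsto_dz_dz hν_pos hν_le hC
  have hc := h.tendsto_dzbar_dz
  have hnorm : ∀ w : ℂ, ‖p + cexp w - p‖ = Real.exp w.re := fun w => by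
    rw [add_sub_cancel_left, norm_exp]
  have hlog : ∀ w : ℂ, Real.log (1 / Real.exp w.re) = -w.re := fun w => by
    rw [one_div, Real.log_inv, Real.log_exp]
  have hexp : ∀ w : ℂ, cexp (V w - w.re) * cexp w.re = cexp (V w) := fun w => by
    rw [← exp_add, sub_add_cancel]
  refine ⟨tendsto_punctured_of_comp_add_cexp ?_, tendsto_punctured_of_comp_add_cexp ?_,
    tendsto_punctured_of_comp_add_cexp ?_⟩
  · have hlim := hE.mul ha
    rw [show ((1 / √k₀ : ℝ) : ℂ) * (0 - 1 / 2) = ((-(1 / (2 * √k₀)) : ℝ) : ℂ) by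
      push_cast; ring] at hlim
    refine hlim.congr' ?_
    filter_upwards [hloc] with w hw
    have h1 := dz_density_mul_cexp (hw.mono fun z hz => hz.1) hw.self_of_nhds.2
    rw [hnorm, hlog, add_sub_cancel_left]
    push_cast
    rw [← hexp]
    linear_combination -(cexp w.re * -w.re) * h1
  · have hlim := hE.mul (((ha.pow 2).add hb).sub ha)
    rw [show ((1 / √k₀ : ℝ) : ℂ) * ((0 - 1 / 2) ^ 2 + 0 - (0 - 1 / 2)) =
      ((3 / (4 * √k₀) : ℝ) : ℂ) by push_cast; ring] at hlim
    refine hlim.congr' ?_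
    filter_upwards [hloc] with w hw
    have h1 := (second_derivatives_density hw).1
    rw [hnorm, hlog, add_sub_cancel_left]
    push_cast
    rw [← hexp]
    linear_combination -(cexp w.re * -w.re) * h1
  · have hconj := (continuous_conj.tendsto _).comp ha
    have hlim := hE.mul ((hconj.mul ha).add hc)
    rw [show ((1 / √k₀ : ℝ) : ℂ) * (conj (0 - 1 / 2) * (0 - 1 / 2) + 0) =
      ((1 / (4 * √k₀) : ℝ) : ℂ) by
        rw [zero_sub, map_neg, map_div₀, map_one, map_ofNat]; push_cast; ring] at hlim
    refine hlim.congr' ?_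
    filter_upwards [hloc] with w hw
    have h1 := (second_derivatives_density hw).2
    rw [conj_mul', norm_exp] at h1
    rw [hnorm, hlog]
    simp only [Function.comp_apply]
    push_cast at h1 ⊢
    rw [← hexp]
    linear_combination -(cexp w.re * -w.re) * h1

end ConformalMetric

theorem mainTheorem4
    (Ω : Set ℂ) (p : ℂ) (lam κ : ℂ → ℝ) (ν : ℝ≥0)
    (hΩ_open : IsOpen Ω) (hΩ_conn : IsConnected Ω)
    -- `p` is an isolated singularity: `p ∉ Ω`, and `Ω` contains a punctured neighbourhood of `p`
    (hp : p ∉ Ω) (hp_isol : Ω ∈ 𝓝[≠] p)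
    (hlam : ConformalMetric.IsRegular lam Ω)
    -- `κ` is a Hölder continuous extension of the curvature to `Ω ∪ {p}`
    (hκ_curv : ∀ z ∈ Ω, κ z = ConformalMetric.curvature lam z)
    (hν_pos : 0 < ν) (hν_le : ν ≤ 1)
    (hκ_holder : ConformalMetric.LocallyHolderOn ν κ (Ω ∪ {p}))
    (hκ_neg : κ p < 0)
    (horder : ConformalMetric.HasOrderAt (fun z => Real.log (lam z)) p 1) :
    Tendsto (fun z : ℂ => (z - p) * ((‖z - p‖ * Real.log (1 / ‖z - p‖) : ℝ) : ℂ) *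
        ConformalMetric.dz (fun w => (lam w : ℂ)) z)
      (𝓝[≠] p) (𝓝 ((-(1 / (2 * Real.sqrt (-κ p))) : ℝ) : ℂ)) ∧
    Tendsto (fun z : ℂ => (z - p) ^ 2 * ((‖z - p‖ * Real.log (1 / ‖z - p‖) : ℝ) : ℂ) *
        ConformalMetric.dz (ConformalMetric.dz (fun w => (lam w : ℂ))) z)
      (𝓝[≠] p) (𝓝 ((3 / (4 * Real.sqrt (-κ p)) : ℝ) : ℂ)) ∧
    Tendsto (fun z : ℂ => ((‖z - p‖ ^ 3 * Real.log (1 / ‖z - p‖) : ℝ) : ℂ) *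
        ConformalMetric.dzbar (ConformalMetric.dz (fun w => (lam w : ℂ))) z)
      (𝓝[≠] p) (𝓝 ((1 / (4 * Real.sqrt (-κ p)) : ℝ) : ℂ)) := by
  have h := ConformalMetric.isCuspPotential_logDensity hΩ_open hp_isol hlam hκ_curv hν_pos
    hκ_holder hκ_neg horder
  obtain ⟨C, hC⟩ := ConformalMetric.exists_holder_comp_add_cexp hp_isol hκ_holder
  refine ConformalMetric.tendsto_derivatives_density h (NNReal.coe_pos.2 hν_pos)
    (NNReal.coe_le_one.2 hν_le) hC (ConformalMetric.eventually_nhds_re_atBot ?_)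
  filter_upwards [(ConformalMetric.tendsto_add_cexp p).eventually hp_isol] with w hw
  exact ⟨hlam.pos _ hw, hlam.contDiffOn.contDiffAt (hΩ_open.mem_nhds hw)⟩
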